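/- For $s\in\mathbb R$ let $\Gamma_s=\{(b,a)\in\mathbb R^2 : a\neq 0,\ (1+sb)(a-sb)\neq 0\}$. It is a groupoid over $\mathbb R\setminus\{0\}$ with left and right projections $(b,a)\mapsto a-sb$ and $(b,a)\mapsto \frac{a}{1+sb}$, product $(b_1,a_1)(b_2,a_2)=(b_1+(1+sb_1)b_2,\,(1+sb_1)a_2)$ of composable pairs, and inverse $(b,a)^{-1}=\left(\frac{-b}{1+sb},\frac{a-sb}{1+sb}\right)$. Let $\mathcal D(\Gamma_s)$ be the space of smooth, compactly supported, complex valued functions on $\Gamma_s$, extended by zero to the plane, with $$(f*_sg)(b,a)=\int_{\mathbb R}\frac{dc}{|1+sc|}\,f\big(c,a+s(c-b)\big)\,g\Big(\frac{b-c}{1+sc},\frac{a}{1+sc}\Big),\qquad f^{*_s}(b,a)=\overline{f\Big(\frac{-b}{1+sb},\frac{a-sb}{1+sb}\Big)},$$ $[f,g]=f*_sg-g*_sf$, and with the reduced norm $\|f\|_s$, i.e. the norm of the operator $\pi_s(f):g\mapsto f*_sg$ on $L^2(\Gamma_s,\frac{da\,db}{a^2})$, which is defined on the dense subspace $\mathcal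 D(\Gamma_s)$. Write $f*g=f*_0g$, $f^*=f^{*_0}$, and for $f,g\in\mathcal D(\Gamma_0)$ put $$\{f,g\}=(a-1)\big[(\partial_af)*(bg)-(\partial_ag)*(bf)\big].$$ Let $D(Q_s)=\{f\in\mathcal D(\Gamma_0): f\in\mathcal D(\Gamma_\delta)\text{ whenever }|\delta|\le|s|\}$ and let $Q_s:D(Q_s)\to\mathcal D(\Gamma_s)$ be the linear map $Q_s(f)=f$. **Proposition 6.3.** For each $s$ and each $f\in\mathcal D(\Gamma_s)$ the norm $\|f\|_s$ is finite, and for each $f\in\mathcal D(\Gamma_0)$ the set $\{s: f\in D(Q_s)\}$ is an open neighbourhood of $0$. Moreover, for all $f,g\in\mathcal D(\Gamma_0)$: 1. $D(Q_0)=\mathcal D(\Gamma_0)$ and $Q_0=\mathrm{id}$; 2. $\lim_{s\to0}\|Q_s(f^*)-Q_s(f)^{*_s}\|_s=0$; 3. $\lim_{s\to0}\|Q_s(f)*_sQ_s(g)-Q_s(f*g)\|_s=0$; 4. $\lim_{s\to0}\left\|\frac1s[Q_s(f),Q_s(g)]-Q_s(\{f,g\})\right\|_s=0$ (limit over $s\ne0$);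 5. the function $s\mapsto\|Q_s(f)\|_s$, defined on $\{s:f\in D(Q_s)\}$, is continuous at every $s\neq0$ and lower semicontinuous at $s=0$. -/

import Mathlib

open Set Filter Topology MeasureTheory
open scoped ENNReal ContDiff

namespace AxB

/-! The differential groupoids `Γ_s` (over `A = ℝ \ {0}`), as open subsets of the `(b, a)`-plane. -/

/-- `Γ_s = {(b, a) : a ≠ 0, (1 + s b)(a - s b) ≠ 0}`, an open dense subset of the group
`G = ℝ × (ℝ \ {0})`. -/
def Gam (s : ℝ) : Set (ℝ × ℝ) := {x | x.2 ≠ 0 ∧ (1 + s * x.1) * (x.2 - s * x.1) ≠ 0}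

/-- Left (target) projection `Γ_s → A`. -/
def tgt (s : ℝ) (x : ℝ × ℝ) : ℝ := x.2 - s * x.1

/-- Right (source) projection `Γ_s → A`. -/
noncomputable def src (s : ℝ) (x : ℝ × ℝ) : ℝ := x.2 / (1 + s * x.1)

/-- The groupoid product of `Γ_s`, meaningful for composable pairs (`src s x = tgt s y`). -/
def gmul (s : ℝ) (x y : ℝ × ℝ) : ℝ × ℝ := (x.1 + (1 + s * x.1) * y.1, (1 + s * x.1) * y.2)

/-- The groupoid inverse of `Γ_s`. -/
noncomputable def ginv (s : ℝ) (x : ℝ × ℝ) : ℝ × ℝ :=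
  (-x.1 / (1 + s * x.1), (x.2 - s * x.1) / (1 + s * x.1))

/-- `𝒟(Γ_s)`: smooth functions with compact support contained in `Γ_s` (extended by zero to
the plane). Through the choice of the half densities `ω_s` it is the groupoid algebra
of `Γ_s`. -/
def D (s : ℝ) : Submodule ℂ (ℝ × ℝ → ℂ) where
  carrier := {f | ContDiff ℝ ∞ f ∧ HasCompactSupport f ∧ tsupport f ⊆ Gam s}
  add_mem' := by
    rintro f g ⟨hf, hf', hf''⟩ ⟨hg, hg', hg''⟩
    exact ⟨hf.add hg, hf'.add hg', (tsupport_add f g).trans (union_subset hf'' hg'')⟩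
  zero_mem' := ⟨contDiff_const, HasCompactSupport.zero, by simp [tsupport]⟩
  smul_mem' := by
    rintro c f ⟨hf, hf', hf''⟩
    exact ⟨contDiff_const.smul hf, hf'.smul_left, (closure_mono (by
      intro x hx h
      exact hx (by simp [h]))).trans hf''⟩

theorem mem_D_of {s : ℝ} {f : ℝ × ℝ → ℂ} (hf : ContDiff ℝ ∞ f) {K : Set (ℝ × ℝ)}
    (hK : IsCompact K) (hKs : K ⊆ Gam s) (h : ∀ x, f x ≠ 0 → x ∈ K) : f ∈ D s := by
  have hsub : tsupport f ⊆ K := closure_minimal (fun x hx => h x hx) hK.isClosed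
  exact ⟨hf, hK.of_isClosed_subset (isClosed_tsupport f) hsub, hsub.trans hKs⟩

theorem smul_mem_D {s : ℝ} {φ : ℝ × ℝ → ℂ} (hφ : ContDiff ℝ ∞ φ) {f : ℝ × ℝ → ℂ}
    (hf : f ∈ D s) : (fun x => φ x * f x) ∈ D s :=
  mem_D_of (hφ.mul hf.1) hf.2.1 hf.2.2 fun _ hx =>
    subset_tsupport f (right_ne_zero_of_mul hx)

/-- `∂f/∂a`. -/
noncomputable def dA (f : ℝ × ℝ → ℂ) (x : ℝ × ℝ) : ℂ := fderiv ℝ f x (0, 1)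

theorem dA_mem_D {s : ℝ} {f : ℝ × ℝ → ℂ} (hf : f ∈ D s) : dA f ∈ D s := by
  refine mem_D_of ?_ hf.2.1 hf.2.2 ?_
  · exact (hf.1.fderiv_right (m := ∞) (by simp)).clm_apply contDiff_const
  · intro x hx
    refine tsupport_fderiv_subset ℝ (subset_tsupport _ ?_)
    intro h0
    exact hx (by simp [dA, h0])

/-- The function `f^{*_s}(γ) = conj (f(γ⁻¹))`. -/
noncomputable def involFun (s : ℝ) (f : ℝ × ℝ → ℂ) (x : ℝ × ℝ) : ℂ :=
  (starRingEnd ℂ) (f (ginv s x))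

/-- The convolution `(f *_s g)(γ) = ∫ f(γ') g(γ'⁻¹ γ)`, over the `γ' = (c, a + s (c - b))` in
the left fibre through `γ = (b, a)`, with respect to the left invariant measure
`dc / |1 + s c|` (the square of the half density `λ_s`); then
`γ'⁻¹ γ = ((b - c)/(1 + s c), a/(1 + s c))`. -/
noncomputable def convFun (s : ℝ) (f g : ℝ × ℝ → ℂ) (x : ℝ × ℝ) : ℂ :=
  ∫ c : ℝ, ((|1 + s * c|⁻¹ : ℝ) : ℂ) * f (c, x.2 + s * (c - x.1)) *
    g ((x.1 - c) / (1 + s * c), x.2 / (1 + s * c))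

theorem zero_of_not_mem {s : ℝ} {f : ℝ × ℝ → ℂ} (hf : f ∈ D s) {x : ℝ × ℝ}
    (hx : x ∉ Gam s) : f x = 0 := by
  by_contra h
  exact hx (hf.2.2 (subset_tsupport f h))

theorem involFun_mem_D {s : ℝ} {f : ℝ × ℝ → ℂ} (hf : f ∈ D s) : involFun s f ∈ D s := by
  have hcont : ContinuousOn (ginv s) (Gam s) := by
    unfold ginv
    refine ContinuousOn.prodMk (ContinuousOn.div (by fun_prop) (by fun_prop) ?_)
      (ContinuousOn.div (by fun_prop) (by fun_prop) ?_)
    all_goals exact fun x hx => left_ne_zero_of_mul hx.2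
  have hK : IsCompact (ginv s '' tsupport f) :=
    IsCompact.image_of_continuousOn hf.2.1 (hcont.mono hf.2.2)
  have hKs : ginv s '' tsupport f ⊆ Gam s := by
    rintro _ ⟨x, hx, rfl⟩
    obtain ⟨h1, h2⟩ := hf.2.2 hx
    have h3 := left_ne_zero_of_mul h2
    have h4 := right_ne_zero_of_mul h2
    refine ⟨div_ne_zero h4 h3, mul_ne_zero ?_ ?_⟩
    · have : 1 + s * (ginv s x).1 = 1 / (1 + s * x.1) := by
        simp only [ginv]; field_simp; ring
      rw [this]; exact one_div_ne_zero h3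
    · have : (ginv s x).2 - s * (ginv s x).1 = x.2 / (1 + s * x.1) := by
        simp only [ginv]; field_simp; ring
      rw [this]; exact div_ne_zero h1 h3
  have hmem : ∀ x, involFun s f x ≠ 0 → x ∈ ginv s '' tsupport f := by
    intro x hx
    have h0 : f (ginv s x) ≠ 0 := by
      intro h; exact hx (by simp [involFun, h])
    have h1 := subset_tsupport f h0
    refine ⟨ginv s x, h1, ?_⟩
    have h2 := (hf.2.2 h1).1
    have h3 : 1 + s * x.1 ≠ 0 := by
      intro h; exact h2 (by simp [ginv, h])
    have h5 : 1 + s * (ginv s x).1 = 1 / (1 + s * x.1) := by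
      simp only [ginv]; field_simp; ring
    have h6 : (ginv s x).2 - s * (ginv s x).1 = x.2 / (1 + s * x.1) := by
      simp only [ginv]; field_simp; ring
    apply Prod.ext
    · change -(ginv s x).1 / (1 + s * (ginv s x).1) = x.1
      rw [h5]; simp only [ginv]; rw [one_div, div_inv_eq_mul, neg_div, neg_neg,
        div_mul_cancel₀ _ h3]
    · change ((ginv s x).2 - s * (ginv s x).1) / (1 + s * (ginv s x).1) = x.2
      rw [h5, h6]; field_simp
  refine mem_D_of ?_ hK hKs hmem
  rw [contDiff_iff_contDiffAt]
  intro x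
  by_cases h : 1 + s * x.1 = 0
  · have hx : x ∉ ginv s '' tsupport f := fun hx => (hKs hx).2 (by simp [h])
    have : involFun s f =ᶠ[𝓝 x] fun _ => 0 := by
      filter_upwards [hK.isClosed.isOpen_compl.mem_nhds hx] with y hy
      by_contra h'
      exact hy (hmem y h')
    exact contDiffAt_const.congr_of_eventuallyEq this
  · have : ContDiffAt ℝ ∞ (ginv s) x := by
      unfold ginv
      exact ContDiffAt.prodMk (ContDiffAt.div (by fun_prop) (by fun_prop) h)
        (ContDiffAt.div (by fun_prop) (by fun_prop) h)
    exact Complex.conjCLE.contDiff.contDiffAt.comp x (hf.1.contDiffAt.comp x this)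

theorem convFun_contDiff {s : ℝ} {f g : ℝ × ℝ → ℂ} (hf : f ∈ D s) (hg : g ∈ D s) :
    ContDiff ℝ ∞ (convFun s f g) := by
  set F : ℝ × ℝ → ℝ → ℂ := fun x c => ((|1 + s * c|⁻¹ : ℝ) : ℂ) * f (c, x.2 + s * (c - x.1)) *
    g ((x.1 - c) / (1 + s * c), x.2 / (1 + s * c)) with hF
  set K : Set ℝ := Prod.fst '' tsupport f with hKdef
  have hK : IsCompact K := IsCompact.image hf.2.1 continuous_fst
  have hK0 : ∀ c ∈ K, 1 + s * c ≠ 0 := by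
    rintro _ ⟨y, hy, rfl⟩
    exact left_ne_zero_of_mul (hf.2.2 hy).2
  have hFK : ∀ x c, c ∉ K → F x c = 0 := by
    intro x c hc
    have : f (c, x.2 + s * (c - x.1)) = 0 := by
      by_contra h
      exact hc ⟨_, subset_tsupport f h, rfl⟩
    simp [hF, this]
  have hsm : ContDiff ℝ ∞ (fun q : (ℝ × ℝ) × ℝ => F q.1 q.2) := by
    rw [contDiff_iff_contDiffAt]
    rintro ⟨x, c⟩
    by_cases hc : c ∈ K
    · have h0 : 1 + s * ((x, c) : (ℝ × ℝ) × ℝ).2 ≠ 0 := hK0 c hc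
      have h1 : ContDiffAt ℝ ∞ (fun q : (ℝ × ℝ) × ℝ => 1 + s * q.2) (x, c) := by fun_prop
      have h2 : ContDiffAt ℝ ∞ (fun q : (ℝ × ℝ) × ℝ => ((|1 + s * q.2|⁻¹ : ℝ) : ℂ)) (x, c) :=
        Complex.ofRealCLM.contDiff.contDiffAt.comp (x, c)
          (ContDiffAt.inv (f := fun q : (ℝ × ℝ) × ℝ => |1 + s * q.2|)
            (ContDiffAt.comp (g := fun y : ℝ => |y|) (x, c) (contDiffAt_abs h0) h1)
            (abs_ne_zero.2 h0))
      have h3 : ContDiffAt ℝ ∞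
          (fun q : (ℝ × ℝ) × ℝ => f (q.2, q.1.2 + s * (q.2 - q.1.1))) (x, c) :=
        (hf.1.comp (g := f) (by fun_prop)).contDiffAt
      have h4 : ContDiffAt ℝ ∞ (fun q : (ℝ × ℝ) × ℝ =>
          (((q.1.1 - q.2) / (1 + s * q.2), q.1.2 / (1 + s * q.2)) : ℝ × ℝ)) (x, c) :=
        ContDiffAt.prodMk (ContDiffAt.div (by fun_prop) h1 h0) (ContDiffAt.div (by fun_prop) h1 h0)
      exact (h2.mul h3).mul (hg.1.contDiffAt.comp (x, c) h4)
    · have : (fun q : (ℝ × ℝ) × ℝ => F q.1 q.2) =ᶠ[𝓝 (x, c)] fun _ => 0 := by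
        have : Prod.snd ⁻¹' Kᶜ ∈ 𝓝 (x, c) :=
          (hK.isClosed.isOpen_compl.preimage continuous_snd).mem_nhds hc
        filter_upwards [this] with q hq
        exact hFK _ _ hq
      exact contDiffAt_const.congr_of_eventuallyEq this
  have key := contDiffOn_convolution_left_with_param (𝕜 := ℝ) (μ := (volume : Measure ℝ))
    (n := ⊤) (ContinuousLinearMap.mul ℝ ℂ) (f := fun _ : ℝ => (1 : ℂ)) (g := F) (s := univ) (k := K)
    isOpen_univ hK (fun p x _ hx => hFK p x hx) (locallyIntegrable_const _)
    hsm.contDiffOn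
  have key' := (contDiffOn_univ.1 (by simpa using key)).comp
    (contDiff_id.prodMk (contDiff_const (c := (0 : ℝ))) : ContDiff ℝ ∞ fun x : ℝ × ℝ => (x, (0 : ℝ)))
  convert key' using 1
  ext x
  simp [convFun, convolution, hF]

theorem convFun_mem_D {s : ℝ} {f g : ℝ × ℝ → ℂ} (hf : f ∈ D s) (hg : g ∈ D s) :
    convFun s f g ∈ D s := by
  set P : Set ((ℝ × ℝ) × (ℝ × ℝ)) :=
    (tsupport f ×ˢ tsupport g) ∩ {p | p.1.2 = (1 + s * p.1.1) * (p.2.2 - s * p.2.1)} with hP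
  have hPc : IsCompact P := (IsCompact.prod hf.2.1 hg.2.1).inter_right
    (isClosed_eq (by fun_prop) (by fun_prop))
  have hc : Continuous fun p : (ℝ × ℝ) × (ℝ × ℝ) => gmul s p.1 p.2 := by
    unfold gmul; fun_prop
  refine mem_D_of (convFun_contDiff hf hg) (hPc.image hc) ?_ ?_
  · rintro _ ⟨⟨x, y⟩, ⟨⟨hx, hy⟩, hxy⟩, rfl⟩
    obtain ⟨hx1, hx2⟩ := hf.2.2 hx
    obtain ⟨hy1, hy2⟩ := hg.2.2 hy
    have hxy' : x.2 = (1 + s * x.1) * (y.2 - s * y.1) := hxy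
    refine ⟨mul_ne_zero (left_ne_zero_of_mul hx2) hy1, mul_ne_zero ?_ ?_⟩
    · have : 1 + s * (gmul s x y).1 = (1 + s * x.1) * (1 + s * y.1) := by
        simp only [gmul]; ring
      exact this ▸ mul_ne_zero (left_ne_zero_of_mul hx2) (left_ne_zero_of_mul hy2)
    · have : (gmul s x y).2 - s * (gmul s x y).1 = x.2 - s * x.1 := by
        simp only [gmul]; rw [hxy']; ring
      exact this ▸ right_ne_zero_of_mul hx2
  · intro x hx
    obtain ⟨c, hc⟩ : ∃ c : ℝ, ((|1 + s * c|⁻¹ : ℝ) : ℂ) * f (c, x.2 + s * (c - x.1)) *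
        g ((x.1 - c) / (1 + s * c), x.2 / (1 + s * c)) ≠ 0 := by
      by_contra! h
      exact hx (by simp only [convFun, h, integral_zero])
    have h1 := right_ne_zero_of_mul (left_ne_zero_of_mul hc)
    have h2 := right_ne_zero_of_mul hc
    have h3 : 1 + s * c ≠ 0 := by
      intro h; exact hc (by simp [h])
    refine ⟨((c, x.2 + s * (c - x.1)), ((x.1 - c) / (1 + s * c), x.2 / (1 + s * c))),
      ⟨⟨subset_tsupport f h1, subset_tsupport g h2⟩, ?_⟩, ?_⟩
    · change x.2 + s * (c - x.1) =
        (1 + s * c) * (x.2 / (1 + s * c) - s * ((x.1 - c) / (1 + s * c)))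
      rw [mul_sub (1 + s * c), mul_div_cancel₀ _ h3, mul_left_comm, mul_div_cancel₀ _ h3]; ring
    · apply Prod.ext
      · simp only [gmul]; rw [mul_div_cancel₀ _ h3]; ring
      · simp only [gmul]; rw [mul_div_cancel₀ _ h3]

/-- The product `*_s` of `𝒟(Γ_s)`. -/
noncomputable def conv (s : ℝ) (f g : D s) : D s := ⟨convFun s f g, convFun_mem_D f.2 g.2⟩

/-- The involution `*_s` of `𝒟(Γ_s)`. -/
noncomputable def invol (s : ℝ) (f : D s) : D s := ⟨involFun s f, involFun_mem_D f.2⟩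

/-- The commutator in `𝒟(Γ_s)`. -/
noncomputable def comm (s : ℝ) (f g : D s) : D s := conv s f g - conv s g f

/-- Multiplication of `f ∈ 𝒟(Γ_0)` by the coordinate `b`. -/
noncomputable def mulB (f : D 0) : D 0 :=
  ⟨fun x => (x.1 : ℂ) * (f : ℝ × ℝ → ℂ) x,
    smul_mem_D (Complex.ofRealCLM.contDiff.comp contDiff_fst) f.2⟩

/-- Multiplication of `f ∈ 𝒟(Γ_0)` by the function `a - 1`. -/
noncomputable def mulA1 (f : D 0) : D 0 :=
  ⟨fun x => ((x.2 - 1 : ℝ) : ℂ) * (f : ℝ × ℝ → ℂ) x,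
    smul_mem_D (Complex.ofRealCLM.contDiff.comp (contDiff_snd.sub contDiff_const)) f.2⟩

/-- `∂f/∂a` for `f ∈ 𝒟(Γ_0)`. -/
noncomputable def partialA (f : D 0) : D 0 := ⟨dA f, dA_mem_D f.2⟩

/-- `{f, g} = (a - 1) [(∂_a f) * (b g) - (∂_a g) * (b f)]` on `𝒟(Γ_0)`. -/
noncomputable def bracket (f g : D 0) : D 0 :=
  mulA1 (conv 0 (partialA f) (mulB g) - conv 0 (partialA g) (mulB f))

/-- The measure `da db / a²` on the plane: the square of the half density `Ψ_s = Ψ_0`. As the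
complement of `Γ_s` is a null set, `L²(Γ_s)` is `L²` of this measure. -/
noncomputable def planeMeasure : Measure (ℝ × ℝ) :=
  (volume : Measure (ℝ × ℝ)).withDensity fun x => ENNReal.ofReal (1 / x.2 ^ 2)

/-- The norm of `L²(Γ_s)`. -/
noncomputable def l2norm (f : ℝ × ℝ → ℂ) : ℝ≥0∞ := eLpNorm f 2 planeMeasure

/-- The reduced norm `‖f‖_s`, as an extended nonnegative number: the operator norm of the
identity representation `π_s(f) : g ↦ f *_s g` on `𝒟(Γ_s)`, a dense subspace of `L²(Γ_s)`. -/
noncomputable def redNorm (s : ℝ) (f : D s) : ℝ≥0∞ :=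
  ⨆ g : D s, l2norm (conv s f g : ℝ × ℝ → ℂ) / l2norm (g : ℝ × ℝ → ℂ)

/-- The partially defined linear map `Q_s : 𝒟(Γ_0) ⊃ D(Q_s) ∋ f ↦ f ∈ 𝒟(Γ_s)`, where
`D(Q_s) = {f ∈ 𝒟(Γ_0) : |δ| ≤ |s| ⇒ f ∈ 𝒟(Γ_δ)}`. -/
def Q (s : ℝ) : D 0 →ₗ.[ℂ] D s where
  domain :=
    { carrier := {f | ∀ δ : ℝ, |δ| ≤ |s| → (f : ℝ × ℝ → ℂ) ∈ D δ}
      add_mem' := fun hf hg δ hδ => (D δ).add_mem (hf δ hδ) (hg δ hδ)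
      zero_mem' := fun δ _ => (D δ).zero_mem
      smul_mem' := fun c _ hf δ hδ => (D δ).smul_mem c (hf δ hδ) }
  toFun :=
    { toFun := fun f => ⟨((f : D 0) : ℝ × ℝ → ℂ), f.2 s le_rfl⟩
      map_add' := fun _ _ => rfl
      map_smul' := fun _ _ => rfl }

end AxB

namespace AxB

/-! ### The norm estimate -/

/-! Everything rests on one bound, `l2norm_convFun_le`: if `|f| ≤ M` and on the support of `f` one
has `|b| ≤ R` and `|1 + s b| ≥ η`, then `‖f‖_s ≤ (M / η) * 2R`. It follows from Cauchy-Schwarz and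
Tonelli, because left translation preserves `da db / a²`. The constant depends on `s` only through
`η`, so uniform convergence to zero with controlled supports forces convergence of the reduced norms
to zero (`exists_redNorm_lt`).

The limits at `s = 0` thus become sup-norm statements. For the involution and the product they are
uniform continuity on compact sets. For the commutator, `*_0` is commutative and the integrand
`kern` is differentiable in `s`, uniformly on compacts, so `[f, g] / s` tends to the antisymmetrized
integral of `kernDeriv`; this equals the bracket after discarding a total derivative in the
integration variable (`integral_kernDeriv_sub`).

For `s ≠ 0` the dilation `b ↦ r b` identifies all the algebras: it preserves reduced norms
(`redNorm_rescale`), so `‖f‖_t` is the norm at a fixed parameter of a dilate of `f`, which depends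
continuously on `t`. No dilation reaches `s = 0`. There the norm is a supremum over test functions
`g`, and for each fixed `g` the quotient converges as `t → 0`, which gives lower semicontinuity
only. -/

theorem continuous_of_mem_D {s : ℝ} (f : D s) : Continuous (f : ℝ × ℝ → ℂ) := f.2.1.continuous

theorem l2norm_sq (h : ℝ × ℝ → ℂ) : l2norm h ^ 2 = ∫⁻ x, ‖h x‖ₑ ^ 2 ∂planeMeasure := by
  rw [l2norm, eLpNorm_eq_lintegral_rpow_enorm_toReal (by norm_num) (by norm_num),
    ← ENNReal.rpow_natCast, ← ENNReal.rpow_mul]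
  simp

instance : SFinite planeMeasure := by unfold planeMeasure; infer_instance

theorem lintegral_planeMeasure {ψ : ℝ × ℝ → ℝ≥0∞} (hψ : Measurable ψ) :
    ∫⁻ x, ψ x ∂planeMeasure = ∫⁻ x : ℝ × ℝ, ENNReal.ofReal (1 / x.2 ^ 2) * ψ x := by
  rw [planeMeasure, lintegral_withDensity_eq_lintegral_mul _ (by fun_prop) hψ]
  rfl

/-- Left invariance: the Jacobian `k²` of the affine map cancels the factor `k⁻²` coming from the
density `a⁻²`. -/
theorem lintegral_comp_div_sub {ψ : ℝ × ℝ → ℝ≥0∞} (hψ : Measurable ψ) {k : ℝ} (hk : k ≠ 0)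
    (c : ℝ) :
    ∫⁻ x : ℝ × ℝ, ψ ((x.1 - c) / k, x.2 / k) ∂planeMeasure = ∫⁻ x, ψ x ∂planeMeasure := by
  rw [lintegral_planeMeasure hψ, lintegral_planeMeasure (by fun_prop)]
  set Ψ : ℝ × ℝ → ℝ≥0∞ := fun x => ENNReal.ofReal (1 / x.2 ^ 2) * ψ x with hΨ
  have hΨm : Measurable Ψ := by fun_prop
  have h1 : ∀ x : ℝ × ℝ, ENNReal.ofReal (1 / x.2 ^ 2) * ψ ((x.1 - c) / k, x.2 / k)
      = ENNReal.ofReal (1 / k ^ 2) * Ψ (k⁻¹ • (x - (c, 0))) := by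
    intro x
    have e : k⁻¹ • (x - (c, 0)) = ((x.1 - c) / k, x.2 / k) := by
      ext <;> simp <;> ring
    rw [e, hΨ, ← mul_assoc, ← ENNReal.ofReal_mul (by positivity)]
    congr 2
    simp only [div_pow, one_div_div]
    rw [one_div_mul_eq_div, div_div, mul_comm, ← div_div, div_self (pow_ne_zero 2 hk)]
  simp_rw [h1]
  rw [lintegral_const_mul _ (by fun_prop),
    lintegral_sub_right_eq_self (fun x => Ψ (k⁻¹ • x)) ((c, 0) : ℝ × ℝ),
    ← lintegral_map hΨm (measurable_const_smul k⁻¹),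
    Measure.map_addHaar_smul _ (inv_ne_zero hk), lintegral_smul_measure, smul_eq_mul,
    ← mul_assoc, ← ENNReal.ofReal_mul (by positivity)]
  simp [hk]

theorem lintegral_comp_mul_fst {ψ : ℝ × ℝ → ℝ≥0∞} (hψ : Measurable ψ) {r : ℝ} (hr : r ≠ 0) :
    ∫⁻ x : ℝ × ℝ, ψ (r * x.1, x.2) ∂planeMeasure =
      ENNReal.ofReal |r⁻¹| * ∫⁻ x, ψ x ∂planeMeasure := by
  rw [lintegral_planeMeasure hψ, lintegral_planeMeasure (by fun_prop), Measure.volume_eq_prod,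
    lintegral_prod_symm _ (by fun_prop), lintegral_prod_symm _ (by fun_prop),
    ← lintegral_const_mul _ (by fun_prop)]
  congr 1 with a
  have hm : Measurable fun b : ℝ => ENNReal.ofReal (1 / a ^ 2) * ψ (b, a) := by fun_prop
  have := lintegral_map (μ := volume) hm (measurable_const_mul r)
  rw [Real.map_volume_mul_left hr, lintegral_smul_measure, smul_eq_mul] at this
  exact this.symm

/-- Cauchy-Schwarz against the constant function `1`. -/
theorem sq_lintegral_le {α : Type*} [MeasurableSpace α] (μ : Measure α) {φ : α → ℝ≥0∞}
    (hφ : Measurable φ) : (∫⁻ c, φ c ∂μ) ^ 2 ≤ μ univ * ∫⁻ c, φ c ^ 2 ∂μ := by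
  have h := ENNReal.lintegral_mul_le_Lp_mul_Lq μ (p := 2) (q := 2)
    (by constructor <;> norm_num) (f := fun _ => 1) (g := φ) aemeasurable_const hφ.aemeasurable
  have h2 := pow_le_pow_left' h 2
  rw [mul_pow, ← ENNReal.rpow_natCast, ← ENNReal.rpow_natCast, ← ENNReal.rpow_natCast,
    ← ENNReal.rpow_mul, ← ENNReal.rpow_mul] at h2
  simpa using h2

/-- The integrand of `convFun`. -/
noncomputable def kern (s : ℝ) (f g : ℝ × ℝ → ℂ) (x : ℝ × ℝ) (c : ℝ) : ℂ :=
  ((|1 + s * c|⁻¹ : ℝ) : ℂ) * f (c, x.2 + s * (c - x.1)) *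
    g ((x.1 - c) / (1 + s * c), x.2 / (1 + s * c))

theorem l2norm_convFun_le {s R η M : ℝ} (hη : 0 < η) (hM : 0 ≤ M)
    {f g : ℝ × ℝ → ℂ} (hg : Measurable g)
    (hf : ∀ x, f x ≠ 0 → |x.1| ≤ R ∧ η ≤ |1 + s * x.1|) (hfM : ∀ x, ‖f x‖ ≤ M) :
    l2norm (convFun s f g) ≤ ENNReal.ofReal (M / η * (2 * R)) * l2norm g := by
  set S : Set ℝ := {c | |c| ≤ R ∧ η ≤ |1 + s * c|} with hS
  have hSm : MeasurableSet S :=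
    (measurableSet_le (f := fun c : ℝ => |c|) (g := fun _ => R) (by fun_prop) (by fun_prop)).inter
      (measurableSet_le (f := fun _ => η) (g := fun c : ℝ => |1 + s * c|)
        (by fun_prop) (by fun_prop))
  have hvol : volume S ≤ ENNReal.ofReal (2 * R) := by
    calc volume S ≤ volume (Icc (-R) R) := measure_mono fun c hc => abs_le.1 hc.1
      _ = ENNReal.ofReal (2 * R) := by rw [Real.volume_Icc]; congr 1; ring
  set φ : ℝ × ℝ → ℝ → ℝ≥0∞ := fun x c => ‖g ((x.1 - c) / (1 + s * c), x.2 / (1 + s * c))‖ₑ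
    with hφ
  have hφm : Measurable (Function.uncurry φ) := by unfold Function.uncurry; fun_prop
  have hpt : ∀ x, ‖convFun s f g x‖ₑ ≤ ENNReal.ofReal (M / η) * ∫⁻ c in S, φ x c := by
    intro x
    refine (enorm_integral_le_lintegral_enorm _).trans ?_
    rw [← lintegral_indicator hSm, ← lintegral_const_mul _ (by
      refine Measurable.indicator ?_ hSm; exact hφm.comp measurable_prodMk_left)]
    refine lintegral_mono fun c => ?_
    by_cases h0 : f (c, x.2 + s * (c - x.1)) = 0
    · simp [h0]
    have hc : c ∈ S := hf _ h0
    rw [indicator_of_mem hc, enorm_mul]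
    refine mul_le_mul_left ?_ _
    rw [← ofReal_norm]
    refine ENNReal.ofReal_le_ofReal ?_
    rw [norm_mul, Complex.norm_real, norm_inv, Real.norm_eq_abs, abs_abs, inv_mul_eq_div]
    exact div_le_div₀ hM (hfM _) hη hc.2
  have hsq : l2norm (convFun s f g) ^ 2 ≤
      (ENNReal.ofReal (M / η * (2 * R)) * l2norm g) ^ 2 := by
    rw [mul_pow, l2norm_sq, l2norm_sq]
    calc ∫⁻ x, ‖convFun s f g x‖ₑ ^ 2 ∂planeMeasure
        ≤ ∫⁻ x, ENNReal.ofReal (M / η) ^ 2 *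
            (ENNReal.ofReal (2 * R) * ∫⁻ c in S, φ x c ^ 2) ∂planeMeasure := by
          refine lintegral_mono fun x => ?_
          refine (pow_le_pow_left' (hpt x) 2).trans ?_
          rw [mul_pow]
          -- Cauchy-Schwarz in `c` over `S`, whose measure is at most `2R`; the second factor `2R`
          -- appears below, when the translation-invariant inner integral is integrated over `S`.
          refine mul_le_mul_right ((sq_lintegral_le _ (hφm.comp measurable_prodMk_left)).trans ?_) _
          rw [Measure.restrict_apply_univ]
          exact mul_le_mul_left hvol _
      _ = ENNReal.ofReal (M / η) ^ 2 * (ENNReal.ofReal (2 * R) *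
            ∫⁻ c in S, ∫⁻ x, φ x c ^ 2 ∂planeMeasure) := by
          have hm : Measurable fun x => ∫⁻ c in S, φ x c ^ 2 :=
            Measurable.lintegral_prod_right' (f := fun p : (ℝ × ℝ) × ℝ => φ p.1 p.2 ^ 2)
              (hφm.pow_const 2)
          rw [lintegral_const_mul _ (by fun_prop), lintegral_const_mul _ hm,
            lintegral_lintegral_swap]
          exact (hφm.pow_const 2).aemeasurable
      _ = ENNReal.ofReal (M / η) ^ 2 * (ENNReal.ofReal (2 * R) *
            ∫⁻ c in S, ∫⁻ x, ‖g x‖ₑ ^ 2 ∂planeMeasure) := by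
          congr 2
          refine setLIntegral_congr_fun hSm fun c hc => ?_
          exact lintegral_comp_div_sub (ψ := fun x => ‖g x‖ₑ ^ 2) (by fun_prop)
            (abs_pos.1 (hη.trans_le hc.2)) c
      _ ≤ ENNReal.ofReal (M / η) ^ 2 * (ENNReal.ofReal (2 * R) *
            (ENNReal.ofReal (2 * R) * ∫⁻ x, ‖g x‖ₑ ^ 2 ∂planeMeasure)) := by
          rw [setLIntegral_const, mul_comm (lintegral _ _)]
          gcongr
      _ = _ := by
          rw [ENNReal.ofReal_mul (p := M / η) (by positivity)]; ring
  exact (ENNReal.pow_le_pow_left_iff two_ne_zero).1 hsq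

theorem redNorm_le {s R η M : ℝ} (hη : 0 < η) (hM : 0 ≤ M) (f : D s)
    (hf : ∀ x, (f : ℝ × ℝ → ℂ) x ≠ 0 → |x.1| ≤ R ∧ η ≤ |1 + s * x.1|)
    (hfM : ∀ x, ‖(f : ℝ × ℝ → ℂ) x‖ ≤ M) :
    redNorm s f ≤ ENNReal.ofReal (M / η * (2 * R)) :=
  iSup_le fun g => ENNReal.div_le_of_le_mul
    (l2norm_convFun_le hη hM (continuous_of_mem_D g).measurable hf hfM)

theorem exists_redNorm_lt {R η : ℝ} (hη : 0 < η) (hR : 0 ≤ R) {ε : ℝ≥0∞} (hε : 0 < ε) :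
    ∃ δ : ℝ, 0 < δ ∧ ∀ (s : ℝ) (f : D s),
      (∀ x, (f : ℝ × ℝ → ℂ) x ≠ 0 → |x.1| ≤ R ∧ η ≤ |1 + s * x.1|) →
      (∀ x, ‖(f : ℝ × ℝ → ℂ) x‖ ≤ δ) → redNorm s f < ε := by
  obtain ⟨e, he0, he⟩ : ∃ e : ℝ, 0 < e ∧ ENNReal.ofReal e < ε := by
    obtain ⟨e, h1, h2⟩ := ENNReal.lt_iff_exists_nnreal_btwn.1 hε
    exact ⟨e, by exact_mod_cast h1, by simpa using h2⟩
  -- The `+ 1` keeps the denominator positive when `R = 0`.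
  refine ⟨e * η / (2 * R + 1), by positivity, fun s f hf hfM => ?_⟩
  refine (redNorm_le hη (by positivity) f hf hfM).trans_lt (lt_of_le_of_lt ?_ he)
  refine ENNReal.ofReal_le_ofReal ?_
  rw [div_div, div_mul_eq_mul_div, div_le_iff₀ (by positivity)]
  nlinarith [mul_pos he0 hη]

/-- On the compact support the nonvanishing functions `a` and `1 + s b` have bounded inverses; `η`
is the reciprocal of a common bound. -/
theorem exists_bounds {s : ℝ} (f : D s) : ∃ R η M : ℝ, 0 < R ∧ 0 < η ∧ 0 ≤ M ∧
    (∀ x, (f : ℝ × ℝ → ℂ) x ≠ 0 → |x.1| ≤ R ∧ |x.2| ≤ R ∧ η ≤ |x.2| ∧ η ≤ |1 + s * x.1|) ∧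
    ∀ x, ‖(f : ℝ × ℝ → ℂ) x‖ ≤ M := by
  obtain ⟨M, hM⟩ := f.2.2.1.exists_bound_of_continuous (continuous_of_mem_D f)
  have hK : IsCompact (tsupport (f : ℝ × ℝ → ℂ)) := f.2.2.1
  obtain ⟨R, hR⟩ := hK.exists_bound_of_continuousOn (f := fun x => x) continuousOn_id
  obtain ⟨A, hA⟩ := hK.exists_bound_of_continuousOn (f := fun x : ℝ × ℝ => (x.2)⁻¹)
    (ContinuousOn.inv₀ (by fun_prop) fun x hx => (f.2.2.2 hx).1)
  obtain ⟨B, hB⟩ := hK.exists_bound_of_continuousOn (f := fun x : ℝ × ℝ => (1 + s * x.1)⁻¹)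
    (ContinuousOn.inv₀ (by fun_prop) fun x hx => left_ne_zero_of_mul (f.2.2.2 hx).2)
  have hinv : ∀ {y C : ℝ}, y ≠ 0 → ‖y⁻¹‖ ≤ C → C ≤ max 1 (max A B) →
      (max 1 (max A B))⁻¹ ≤ |y| := by
    intro y C hy h1 h2
    rw [norm_inv, Real.norm_eq_abs] at h1
    exact inv_le_of_inv_le₀ (abs_pos.2 hy) (h1.trans h2)
  refine ⟨max 1 R, (max 1 (max A B))⁻¹, M, by positivity, by positivity,
    (norm_nonneg _).trans (hM 0), fun x hx => ?_, hM⟩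
  have hx' := subset_tsupport _ hx
  exact ⟨(norm_fst_le x).trans ((hR x hx').trans (le_max_right _ _)),
    (norm_snd_le x).trans ((hR x hx').trans (le_max_right _ _)),
    hinv (f.2.2.2 hx').1 (hA x hx') ((le_max_left _ _).trans (le_max_right _ _)),
    hinv (left_ne_zero_of_mul (f.2.2.2 hx').2) (hB x hx')
      ((le_max_right _ _).trans (le_max_right _ _))⟩

theorem redNorm_lt_top (s : ℝ) (f : D s) : redNorm s f < ⊤ := by
  obtain ⟨R, η, M, hR, hη, hM, h1, h2⟩ := exists_bounds f
  exact (redNorm_le hη hM f (fun x hx => ⟨(h1 x hx).1, (h1 x hx).2.2.2⟩) h2).trans_lt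
    ENNReal.ofReal_lt_top

/-! ### Linearity of the convolution and the triangle inequality -/

theorem continuous_kern {s : ℝ} {f g : ℝ × ℝ → ℂ} (hf : f ∈ D s) (hg : Continuous g)
    (x : ℝ × ℝ) : Continuous (kern s f g x) ∧ HasCompactSupport (kern s f g x) := by
  set K : Set ℝ := Prod.fst '' tsupport f with hKdef
  have hK : IsCompact K := IsCompact.image hf.2.1 continuous_fst
  have hK0 : ∀ c, c ∉ K → kern s f g x c = 0 := by
    intro c hc
    have : f (c, x.2 + s * (c - x.1)) = 0 := by
      by_contra h
      exact hc ⟨_, subset_tsupport f h, rfl⟩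
    simp [kern, this]
  refine ⟨continuous_iff_continuousAt.2 fun c => ?_, HasCompactSupport.intro hK hK0⟩
  by_cases hc : c ∈ K
  · have h0 : 1 + s * c ≠ 0 := by
      obtain ⟨y, hy, rfl⟩ := hc
      exact left_ne_zero_of_mul (hf.2.2 hy).2
    have hfc := hf.1.continuous
    unfold kern
    refine ContinuousAt.mul (ContinuousAt.mul ?_ (by fun_prop)) ?_
    · exact Complex.continuous_ofReal.continuousAt.comp
        (ContinuousAt.inv₀ (by fun_prop) (abs_ne_zero.2 h0))
    · exact hg.continuousAt.comp (ContinuousAt.prodMk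
        (ContinuousAt.div (by fun_prop) (by fun_prop) h0)
        (ContinuousAt.div (by fun_prop) (by fun_prop) h0))
  · have : kern s f g x =ᶠ[𝓝 c] fun _ => 0 := by
      filter_upwards [hK.isClosed.isOpen_compl.mem_nhds hc] with c' hc'
      exact hK0 c' hc'
    exact continuousAt_const.congr_of_eventuallyEq this

theorem integrable_kern {s : ℝ} {f g : ℝ × ℝ → ℂ} (hf : f ∈ D s) (hg : Continuous g)
    (x : ℝ × ℝ) : Integrable (kern s f g x) :=
  (continuous_kern hf hg x).1.integrable_of_hasCompactSupport (continuous_kern hf hg x).2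

theorem convFun_add {s : ℝ} (f f' g : D s) (x : ℝ × ℝ) :
    convFun s (f + f' : D s) g x = convFun s f g x + convFun s f' g x := by
  have h : ∀ c, kern s (f + f' : D s) g x c = kern s f g x c + kern s f' g x c := by
    intro c; simp only [kern, Submodule.coe_add, Pi.add_apply]; ring
  calc convFun s (f + f' : D s) g x = ∫ c, (kern s f g x c + kern s f' g x c) := by
        simp_rw [← h]; rfl
    _ = _ := integral_add (integrable_kern f.2 (continuous_of_mem_D g) x)
        (integrable_kern f'.2 (continuous_of_mem_D g) x)

theorem redNorm_add_le {s : ℝ} (f f' : D s) : redNorm s (f + f') ≤ redNorm s f + redNorm s f' := by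
  refine iSup_le fun g => ?_
  have h : l2norm (conv s (f + f') g : ℝ × ℝ → ℂ) ≤
      l2norm (conv s f g : ℝ × ℝ → ℂ) + l2norm (conv s f' g : ℝ × ℝ → ℂ) := by
    have e : (conv s (f + f') g : ℝ × ℝ → ℂ) = (conv s f g : ℝ × ℝ → ℂ) + conv s f' g :=
      funext (convFun_add f f' g)
    rw [e]
    exact eLpNorm_add_le (continuous_of_mem_D _).aestronglyMeasurable
      (continuous_of_mem_D _).aestronglyMeasurable (by norm_num)
  refine (ENNReal.div_le_div_right h _).trans ?_
  rw [ENNReal.add_div]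
  exact add_le_add (le_iSup (fun g : D s => l2norm (conv s f g : ℝ × ℝ → ℂ) /
    l2norm (g : ℝ × ℝ → ℂ)) g) (le_iSup (fun g : D s => l2norm (conv s f' g : ℝ × ℝ → ℂ) /
    l2norm (g : ℝ × ℝ → ℂ)) g)

/-! ### Rescaling the groupoid -/

theorem comp_mul_fst_mem_D {s r t : ℝ} (hr : r ≠ 0) (ht : t = r * s) {f : ℝ × ℝ → ℂ}
    (hf : f ∈ D s) : (fun x : ℝ × ℝ => f (r * x.1, x.2)) ∈ D t := by
  have hK : IsCompact ((fun x : ℝ × ℝ => (r⁻¹ * x.1, x.2)) '' tsupport f) :=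
    IsCompact.image hf.2.1 (by fun_prop)
  refine mem_D_of (hf.1.comp (by fun_prop)) hK ?_ fun x hx => ⟨_, subset_tsupport f hx, ?_⟩
  · rintro _ ⟨x, hx, rfl⟩
    have := hf.2.2 hx
    have e : t * (r⁻¹ * x.1) = s * x.1 := by rw [ht]; field_simp
    simpa only [Gam, mem_ofPred_eq, e] using this
  · simp [hr]

theorem l2norm_comp_mul_fst {r : ℝ} (hr : r ≠ 0) {h : ℝ × ℝ → ℂ} (hh : Measurable h) :
    l2norm (fun x => h (r * x.1, x.2)) = ENNReal.ofReal |r⁻¹| ^ (1 / 2 : ℝ) * l2norm h := by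
  rw [← (ENNReal.pow_right_strictMono two_ne_zero).injective.eq_iff, mul_pow, l2norm_sq, l2norm_sq,
    lintegral_comp_mul_fst (ψ := fun x => ‖h x‖ₑ ^ 2) (by fun_prop) hr, ← ENNReal.rpow_natCast,
    ← ENNReal.rpow_mul]
  norm_num

/-- Substitute `c ↦ r c`: since `t c = s (r c)`, all arguments match, and the Jacobian accounts for
the factor `|r|` put on `f` alone. -/
theorem convFun_comp_mul_fst {s r t : ℝ} (hr : r ≠ 0) (ht : t = r * s) (f g : ℝ × ℝ → ℂ)
    (x : ℝ × ℝ) :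
    convFun t (fun x => ((|r| : ℝ) : ℂ) * f (r * x.1, x.2)) (fun x => g (r * x.1, x.2)) x =
      convFun s f g (r * x.1, x.2) := by
  have h := Measure.integral_comp_mul_left (fun c => kern s f g (r * x.1, x.2) c) r
  have hr' : |r| ≠ 0 := abs_ne_zero.2 hr
  have h' : convFun s f g (r * x.1, x.2) =
      |r| • ∫ c, kern s f g (r * x.1, x.2) (r * c) := by
    rw [h, smul_smul, abs_inv, mul_inv_cancel₀ hr', one_smul]; rfl
  rw [h', ← integral_smul]
  unfold convFun
  congr 1 with c
  have e1 : 1 + t * c = 1 + s * (r * c) := by rw [ht]; ring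
  have e2 : r * ((x.1 - c) / (1 + s * (r * c))) = (r * x.1 - r * c) / (1 + s * (r * c)) := by
    ring
  have e3 : x.2 + t * (c - x.1) = x.2 + s * (r * c - r * x.1) := by rw [ht]; ring
  simp only [e2, e3, e1, kern, Complex.real_smul]
  ring

/-- Dilating test functions intertwines the two convolution operators and multiplies both `L²` norms
by `|r|^(-1/2)`, which cancels in the quotient. -/
theorem redNorm_le_of_rescale {s r t : ℝ} (hr : r ≠ 0) (ht : t = r * s) (f : D s) (f' : D t)
    (hf : ∀ x, (f' : ℝ × ℝ → ℂ) x = (|r| : ℝ) * (f : ℝ × ℝ → ℂ) (r * x.1, x.2)) :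
    redNorm s f ≤ redNorm t f' := by
  refine iSup_le fun g => ?_
  refine le_trans (le_of_eq ?_) (le_iSup (fun g : D t => l2norm (conv t f' g : ℝ × ℝ → ℂ) /
    l2norm (g : ℝ × ℝ → ℂ)) ⟨_, comp_mul_fst_mem_D hr ht g.2⟩)
  have e : (conv t f' ⟨_, comp_mul_fst_mem_D hr ht g.2⟩ : ℝ × ℝ → ℂ) =
      fun x => (conv s f g : ℝ × ℝ → ℂ) (r * x.1, x.2) := by
    funext x
    change convFun t f' (fun x => (g : ℝ × ℝ → ℂ) (r * x.1, x.2)) x = _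
    rw [funext hf]
    exact convFun_comp_mul_fst hr ht f g x
  rw [e, l2norm_comp_mul_fst hr (continuous_of_mem_D _).measurable,
    l2norm_comp_mul_fst hr (continuous_of_mem_D _).measurable]
  have h1 : 0 < |r⁻¹| := abs_pos.2 (inv_ne_zero hr)
  rw [ENNReal.mul_div_mul_left]
  · simp [hr]
  · simp

theorem redNorm_rescale {s r t : ℝ} (hr : r ≠ 0) (ht : t = r * s) (f : D s) (f' : D t)
    (hf : ∀ x, (f' : ℝ × ℝ → ℂ) x = (|r| : ℝ) * (f : ℝ × ℝ → ℂ) (r * x.1, x.2)) :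
    redNorm s f = redNorm t f' := by
  refine le_antisymm (redNorm_le_of_rescale hr ht f f' hf)
    (redNorm_le_of_rescale (inv_ne_zero hr) (by rw [ht]; field_simp) f' f fun x => ?_)
  have : ((|r| : ℝ) : ℂ) ≠ 0 := by simpa using hr
  rw [hf]
  simp [hr, abs_inv]

/-! ### Uniformity on compact sets -/

theorem eventually_norm_sub_lt {X Y E : Type*} [TopologicalSpace X] [TopologicalSpace Y]
    [SeminormedAddCommGroup E] {F : X × Y → E} {x₀ : X} {K : Set Y} (hK : IsCompact K)
    (hF : ∀ y ∈ K, ContinuousAt F (x₀, y)) {ε : ℝ} (hε : 0 < ε) :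
    ∀ᶠ x in 𝓝 x₀, ∀ y ∈ K, ‖F (x, y) - F (x₀, y)‖ < ε := by
  refine hK.eventually_forall_of_forall_eventually fun y hy => ?_
  have h1 := hF y hy
  have h2 : ContinuousAt (fun p : X × Y => F (x₀, p.2)) (x₀, y) :=
    ContinuousAt.comp' (f := fun p : X × Y => (x₀, p.2)) h1 (by fun_prop)
  have h3 : ContinuousAt (fun p : X × Y => ‖F p - F (x₀, p.2)‖) (x₀, y) := (h1.sub h2).norm
  have h4 := h3.eventually (gt_mem_nhds (by simpa using hε : _ < ε))
  exact h4

/-- A first-order expansion uniform over `K`. Strict differentiability at `(0, y)` controls the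
increment between `(s, y')` and `(0, y')` for all `y'` near `y`; continuity of `F'` then replaces
`F' y` by `F' y'`, and compactness finishes. -/
theorem eventually_norm_sub_sub_le {Y : Type*} [NormedAddCommGroup Y] [NormedSpace ℝ Y]
    {F : ℝ × Y → ℂ} {F' : Y → ℂ} {K : Set Y} (hK : IsCompact K)
    (hF : ∀ y, ContDiffAt ℝ 1 F (0, y))
    (hF' : ∀ y, HasDerivAt (fun s => F (s, y)) (F' y) 0) {ε : ℝ} (hε : 0 < ε) :
    ∀ᶠ s in 𝓝 (0 : ℝ), ∀ y ∈ K, ‖F (s, y) - F (0, y) - s • F' y‖ ≤ ε * |s| := by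
  have hF'eq : ∀ y, F' y = fderiv ℝ F (0, y) (1, 0) := by
    intro y
    have h1 : HasDerivAt (fun s : ℝ => (s, y)) ((1 : ℝ), (0 : Y)) 0 :=
      (hasDerivAt_id _).prodMk (hasDerivAt_const _ _)
    exact (hF' y).unique
      (((hF y).differentiableAt one_ne_zero).hasFDerivAt.comp_hasDerivAt (0 : ℝ) h1)
  refine hK.eventually_forall_of_forall_eventually fun y _ => ?_
  have h1 : HasStrictFDerivAt F (fderiv ℝ F (0, y)) (0, y) :=
    (hF y).hasStrictFDerivAt one_ne_zero
  have h2 := h1.isLittleO.def (half_pos hε)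
  have h3 : ContinuousAt (fun p : ℝ × Y => F' p.2) (0, y) := by
    simp_rw [hF'eq]
    have h4 : ContinuousAt (fderiv ℝ F) (0, y) := (hF y).continuousAt_fderiv one_ne_zero
    have h5 : ContinuousAt (fun p : ℝ × Y => fderiv ℝ F (0, p.2)) (0, y) :=
      ContinuousAt.comp' (f := fun p : ℝ × Y => ((0 : ℝ), p.2)) h4 (by fun_prop)
    exact h5.clm_apply continuousAt_const
  have h6 : Tendsto (fun p : ℝ × Y => (p, ((0 : ℝ), p.2))) (𝓝 (0, y)) (𝓝 ((0, y), (0, y))) :=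
    ContinuousAt.tendsto (f := fun p : ℝ × Y => (p, ((0 : ℝ), p.2))) (by fun_prop)
  filter_upwards [h6.eventually h2, Metric.continuousAt_iff'.1 h3 (ε / 2) (half_pos hε)]
    with p hp1 hp2
  have e1 : p - (0, p.2) = p.1 • ((1 : ℝ), (0 : Y)) := by ext <;> simp
  simp only [e1, map_smul, ← hF'eq, norm_smul, Prod.norm_mk, norm_one, norm_zero,
    max_eq_left zero_le_one, mul_one] at hp1
  calc ‖F p - F (0, p.2) - p.1 • F' p.2‖
      = ‖(F p - F (0, p.2) - p.1 • F' y) + p.1 • (F' y - F' p.2)‖ := by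
        rw [smul_sub]; congr 1; ring
    _ ≤ ε / 2 * |p.1| + |p.1| * (ε / 2) := by
        refine norm_add_le_of_le hp1 ?_
        rw [norm_smul, Real.norm_eq_abs, norm_sub_rev, ← dist_eq_norm]
        gcongr
    _ = ε * |p.1| := by ring

/-! ### The domains of the quantization maps -/

theorem isOpen_domain (f : D 0) : IsOpen {s : ℝ | f ∈ (Q s).domain} := by
  have hK : IsCompact (Icc (-1 : ℝ) 1 ×ˢ tsupport (f : ℝ × ℝ → ℂ)) := isCompact_Icc.prod f.2.2.1
  -- Writing `δ = r s` with `|r| ≤ 1` turns the `s`-dependent range of `δ` into a fixed compact set,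
  -- so that the tube lemma applies.
  have e : {s : ℝ | f ∈ (Q s).domain} =
      {s | ∀ p ∈ Icc (-1 : ℝ) 1 ×ˢ tsupport (f : ℝ × ℝ → ℂ), p.2 ∈ Gam (p.1 * s)} := by
    ext s
    constructor
    · rintro h ⟨r, x⟩ ⟨hr, hx⟩
      refine (h (r * s) ?_).2.2 hx
      rw [abs_mul]
      exact mul_le_of_le_one_left (abs_nonneg _) (abs_le.2 hr)
    · intro h δ hδ
      refine ⟨f.2.1, f.2.2.1, fun x hx => ?_⟩
      rcases eq_or_ne s 0 with rfl | hs
      · have : δ = 0 := by simpa using hδ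
        exact this ▸ f.2.2.2 hx
      · have := h (δ / s, x) ⟨abs_le.1 (by rw [abs_div]; exact div_le_one_of_le₀ hδ (abs_nonneg _)),
          hx⟩
        simpa [hs] using this
  rw [e, isOpen_iff_eventually]
  intro s hs
  refine hK.eventually_forall_of_forall_eventually fun p hp => ?_
  obtain ⟨h1, h2⟩ := hs p hp
  have c1 : ContinuousAt (fun q : ℝ × (ℝ × (ℝ × ℝ)) => q.2.2.2) (s, p) := by fun_prop
  have c2 : ContinuousAt (fun q : ℝ × (ℝ × (ℝ × ℝ)) =>
    (1 + q.2.1 * q.1 * q.2.2.1) * (q.2.2.2 - q.2.1 * q.1 * q.2.2.1)) (s, p) := by fun_prop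
  filter_upwards [c1.eventually_ne h1, c2.eventually_ne h2] with q hq1 hq2
  exact ⟨hq1, hq2⟩

theorem mem_domain_zero (f : D 0) : f ∈ (Q 0).domain := by
  intro δ hδ
  have : δ = 0 := by simpa using hδ
  exact this ▸ f.2

theorem eventually_mem_domain (f : D 0) : ∀ᶠ s in 𝓝 (0 : ℝ), f ∈ (Q s).domain :=
  (isOpen_domain f).mem_nhds (mem_domain_zero f)

/-! ### Supports -/

/-- The support of `f` lies in the compact subset `|b|, |a| ≤ R`, `1 ≤ R |a|` of `Γ_0`. -/
def SuppIn (R : ℝ) (f : ℝ × ℝ → ℂ) : Prop := ∀ x, f x ≠ 0 → |x.1| ≤ R ∧ |x.2| ≤ R ∧ 1 ≤ R * |x.2|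

theorem SuppIn.mono {R R' : ℝ} {f : ℝ × ℝ → ℂ} (h : SuppIn R f) (hR : R ≤ R') : SuppIn R' f :=
  fun x hx => ⟨(h x hx).1.trans hR, (h x hx).2.1.trans hR,
    (h x hx).2.2.trans (mul_le_mul_of_nonneg_right hR (abs_nonneg _))⟩

theorem SuppIn.sub {R : ℝ} {f g : ℝ × ℝ → ℂ} (hf : SuppIn R f) (hg : SuppIn R g) :
    SuppIn R (f - g) := fun x hx => by
  by_cases h : f x = 0
  · exact hg x fun h' => hx (by simp [h, h'])
  · exact hf x h

theorem exists_suppIn (f : D 0) : ∃ R : ℝ, 1 ≤ R ∧ SuppIn R f := by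
  obtain ⟨R, η, M, hR, hη, -, h, -⟩ := exists_bounds f
  refine ⟨max 1 (max R η⁻¹), le_max_left _ _, fun x hx => ?_⟩
  obtain ⟨h1, h2, h3, -⟩ := h x hx
  refine ⟨h1.trans (by simp), h2.trans (by simp), ?_⟩
  calc 1 = η⁻¹ * η := (inv_mul_cancel₀ hη.ne').symm
    _ ≤ _ := by gcongr; simp

theorem exists_suppIn₂ (f g : D 0) : ∃ R : ℝ, 1 ≤ R ∧ SuppIn R f ∧ SuppIn R g := by
  obtain ⟨R, hR, hf⟩ := exists_suppIn f
  obtain ⟨R', -, hg⟩ := exists_suppIn g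
  exact ⟨max R R', hR.trans (le_max_left _ _), hf.mono (le_max_left _ _), hg.mono (le_max_right _ _)⟩

theorem abs_one_add_mem {s R b : ℝ} (hs : |s| * R ≤ 1 / 2) (hb : |b| ≤ R) :
    1 / 2 ≤ |1 + s * b| ∧ |1 + s * b| ≤ 3 / 2 := by
  have h : |s * b| ≤ 1 / 2 := by
    rw [abs_mul]; exact (mul_le_mul_of_nonneg_left hb (abs_nonneg _)).trans hs
  obtain ⟨h1, h2⟩ := abs_le.1 h
  rw [abs_of_nonneg (by linarith)]
  constructor <;> linarith

/-- For small `s` the supports of all the products lie in one compact subset of `Γ_0`: the factor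
`|1 + s c|` lies in `[1/2, 3/2]`, which costs at most a factor `3` in the radius. -/
theorem suppIn_convFun {s R : ℝ} (hR : 1 ≤ R) (hs : |s| * R ≤ 1 / 2) {f g : ℝ × ℝ → ℂ}
    (hf : SuppIn R f) (hg : SuppIn R g) : SuppIn (3 * R) (convFun s f g) := by
  intro x hx
  obtain ⟨c, hc⟩ : ∃ c : ℝ, kern s f g x c ≠ 0 := by
    by_contra! h
    exact hx (by change ∫ c, kern s f g x c = 0; simp only [h, integral_zero])
  obtain ⟨h1, -, -⟩ := hf _ (right_ne_zero_of_mul (left_ne_zero_of_mul hc))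
  obtain ⟨h2, h3, h4⟩ := hg _ (right_ne_zero_of_mul hc)
  obtain ⟨h5, h6⟩ := abs_one_add_mem hs h1
  have h0 : 0 < |1 + s * c| := by linarith
  simp only [abs_div] at h1 h2 h3 h4
  rw [div_le_iff₀ h0] at h2 h3
  rw [← mul_div_assoc, le_div_iff₀ h0] at h4
  have h7 : R * |1 + s * c| ≤ R * (3 / 2) := by gcongr
  refine ⟨?_, by linarith, by linarith⟩
  have := abs_sub_abs_le_abs_sub x.1 c
  linarith

theorem involFun_support {s R : ℝ} (hR : 1 ≤ R) (hs : |s| * R ≤ 1 / 2) {f : ℝ × ℝ → ℂ}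
    (hf : SuppIn R f) {x : ℝ × ℝ} (hx : involFun s f x ≠ 0) : |x.1| ≤ 3 * R ∧ |x.2| ≤ 3 * R := by
  have h0 : f (ginv s x) ≠ 0 := fun h => hx (by simp [involFun, h])
  obtain ⟨h1, h2, h3⟩ := hf _ h0
  have h4 : 1 + s * x.1 ≠ 0 := by
    -- If `1 + s b = 0`, division by zero gives the inverse second coordinate `0`, contradicting `1
    -- ≤ R |a|` on the support.
    intro h
    rw [ginv, h] at h3
    norm_num at h3
  have h5 : 0 < |1 + s * x.1| := abs_pos.2 h4
  simp only [ginv, abs_div, abs_neg] at h1 h2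
  rw [div_le_iff₀ h5] at h1 h2
  have h6 : |1 + s * x.1| ≤ 1 + |s| * |x.1| := by
    refine (abs_add_le _ _).trans ?_
    rw [abs_one, abs_mul]
  have h7 : |s| * R * |x.1| ≤ 1 / 2 * |x.1| := by gcongr
  have h8 : R * |1 + s * x.1| ≤ R * (1 + |s| * |x.1|) := by gcongr
  -- Absorption: `|b| ≤ R (1 + |s| |b|) ≤ R + |b| / 2`.
  have h9 : |x.1| ≤ 2 * R := by nlinarith
  have h10 : |s| * |x.1| ≤ |s| * (2 * R) := by gcongr
  have h11 : R * (|s| * |x.1|) ≤ R * 1 := by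
    refine mul_le_mul_of_nonneg_left ?_ (by linarith)
    linarith
  refine ⟨by linarith, ?_⟩
  have h12 := abs_sub_abs_le_abs_sub x.2 (s * x.1)
  rw [abs_mul] at h12
  linarith

theorem eventually_abs_mul_le (R : ℝ) : ∀ᶠ s in 𝓝 (0 : ℝ), |s| * R ≤ 1 / 2 := by
  have : ContinuousAt (fun s : ℝ => |s| * R) 0 := by fun_prop
  exact (this.eventually (gt_mem_nhds (by norm_num : |(0 : ℝ)| * R < 1 / 2))).mono fun _ h => h.le

/-! ### The involution and the product in the limit -/

theorem redNorm_involution_lt (f : D 0) (ε : ℝ≥0∞) (hε : 0 < ε) : ∀ᶠ s : ℝ in 𝓝 0,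
    ∃ (hf : f ∈ (Q s).domain) (hf' : invol 0 f ∈ (Q s).domain),
      redNorm s (Q s ⟨invol 0 f, hf'⟩ - invol s (Q s ⟨f, hf⟩)) < ε := by
  obtain ⟨R, hR, hRf⟩ := exists_suppIn f
  obtain ⟨δ, hδ, H⟩ := exists_redNorm_lt (η := 1 / 2) (R := 3 * R) (by norm_num) (by positivity) hε
  have hK : IsCompact (Icc (-(3 * R)) (3 * R) ×ˢ Icc (-(3 * R)) (3 * R)) :=
    isCompact_Icc.prod isCompact_Icc
  have hcont : ∀ x : ℝ × ℝ, ContinuousAt (fun p : ℝ × (ℝ × ℝ) => involFun p.1 f p.2) (0, x) := by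
    intro x
    have h0 : 1 + ((0 : ℝ), x).1 * ((0 : ℝ), x).2.1 ≠ 0 := by simp
    have h1 : ContinuousAt (fun p : ℝ × (ℝ × ℝ) => ginv p.1 p.2) (0, x) := by
      unfold ginv
      exact ContinuousAt.prodMk (ContinuousAt.div (by fun_prop) (by fun_prop) h0)
        (ContinuousAt.div (by fun_prop) (by fun_prop) h0)
    exact Complex.continuous_conj.continuousAt.comp
      ((continuous_of_mem_D f).continuousAt.comp h1)
  filter_upwards [eventually_mem_domain f, eventually_mem_domain (invol 0 f),
    eventually_abs_mul_le (3 * R), eventually_norm_sub_lt hK (fun x _ => hcont x) hδ]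
    with s h1 h2 h3 h4
  have hval : ∀ x, ((Q s ⟨invol 0 f, h2⟩ - invol s (Q s ⟨f, h1⟩) : D s) : ℝ × ℝ → ℂ) x =
      involFun 0 f x - involFun s f x := fun x => rfl
  have hs : |s| * R ≤ 1 / 2 :=
    (mul_le_mul_of_nonneg_left (by linarith) (abs_nonneg s)).trans h3
  have hsupp : ∀ x, involFun 0 f x - involFun s f x ≠ 0 → |x.1| ≤ 3 * R ∧ |x.2| ≤ 3 * R := by
    intro x hx
    by_cases h : involFun s f x = 0
    · exact involFun_support hR (by norm_num) hRf (x := x) (s := 0) fun h' => hx (by simp [h, h'])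
    · exact involFun_support hR hs hRf h
  refine ⟨h1, h2, H s _ (fun x hx => ?_) (fun x => ?_)⟩
  · rw [hval] at hx
    exact ⟨(hsupp x hx).1, (abs_one_add_mem h3 (hsupp x hx).1).1⟩
  · rw [hval]
    by_cases hx : involFun 0 f x - involFun s f x = 0
    · rw [hx, norm_zero]; exact hδ.le
    · rw [norm_sub_rev]
      exact (h4 x ⟨abs_le.1 (hsupp x hx).1, abs_le.1 (hsupp x hx).2⟩).le

theorem norm_integral_le_of_support {R ε : ℝ} (hR : 0 ≤ R) {h : ℝ → ℂ}
    (hsupp : ∀ c, h c ≠ 0 → |c| ≤ R) (hle : ∀ c, |c| ≤ R → ‖h c‖ ≤ ε) :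
    ‖∫ c, h c‖ ≤ ε * (2 * R) := by
  rw [← setIntegral_eq_integral_of_forall_compl_eq_zero (s := Icc (-R) R) fun c hc => by
    by_contra h0
    exact hc (abs_le.1 (hsupp c h0))]
  refine (norm_setIntegral_le_of_norm_le_const (s := Icc (-R) R) (by simp) fun c hc =>
    hle c (abs_le.2 hc)).trans_eq ?_
  rw [Real.volume_real_Icc_of_le (by linarith)]
  ring

theorem SuppIn.kern {s R : ℝ} {f g : ℝ × ℝ → ℂ} (hf : SuppIn R f) {x : ℝ × ℝ} {c : ℝ}
    (hc : kern s f g x c ≠ 0) : |c| ≤ R :=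
  (hf _ (right_ne_zero_of_mul (left_ne_zero_of_mul hc))).1

/-- At `s = 0` the quantity `1 + s c` equals `1`, so neither the quotients nor the absolute value
obstruct smoothness there. -/
theorem contDiffAt_kern {f g : ℝ × ℝ → ℂ} (hf : ContDiff ℝ ∞ f) (hg : ContDiff ℝ ∞ g)
    (y : (ℝ × ℝ) × ℝ) :
    ContDiffAt ℝ 1 (fun p : ℝ × ((ℝ × ℝ) × ℝ) => kern p.1 f g p.2.1 p.2.2) (0, y) := by
  have hf := hf.of_le (m := 1) (by simp)
  have hg := hg.of_le (m := 1) (by simp)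
  have h0 : 1 + ((0 : ℝ), y).1 * ((0 : ℝ), y).2.2 ≠ 0 := by simp
  have h1 : ContDiffAt ℝ 1 (fun p : ℝ × ((ℝ × ℝ) × ℝ) => 1 + p.1 * p.2.2) (0, y) := by fun_prop
  have h2 : ContDiffAt ℝ 1 (fun p : ℝ × ((ℝ × ℝ) × ℝ) => ((|1 + p.1 * p.2.2|⁻¹ : ℝ) : ℂ)) (0, y) :=
    Complex.ofRealCLM.contDiff.contDiffAt.comp (0, y)
      (ContDiffAt.inv (f := fun p : ℝ × ((ℝ × ℝ) × ℝ) => |1 + p.1 * p.2.2|)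
        (ContDiffAt.comp (g := fun y : ℝ => |y|) (0, y) (contDiffAt_abs h0) h1)
        (abs_ne_zero.2 h0))
  have h3 : ContDiffAt ℝ 1 (fun p : ℝ × ((ℝ × ℝ) × ℝ) =>
      f (p.2.2, p.2.1.2 + p.1 * (p.2.2 - p.2.1.1))) (0, y) :=
    (hf.comp (g := f) (by fun_prop)).contDiffAt
  have h4 : ContDiffAt ℝ 1 (fun p : ℝ × ((ℝ × ℝ) × ℝ) =>
      (((p.2.1.1 - p.2.2) / (1 + p.1 * p.2.2), p.2.1.2 / (1 + p.1 * p.2.2)) : ℝ × ℝ)) (0, y) :=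
    ContDiffAt.prodMk (ContDiffAt.div (by fun_prop) h1 h0) (ContDiffAt.div (by fun_prop) h1 h0)
  exact (h2.mul h3).mul (hg.contDiffAt.comp (0, y) h4)

theorem eventually_convFun_sub_le (f g : D 0) {R δ : ℝ} (hR : 1 ≤ R) (hRf : SuppIn R f)
    (hRg : SuppIn R g) (hδ : 0 < δ) : ∀ᶠ s : ℝ in 𝓝 0,
      SuppIn (3 * R) (convFun s f g - convFun 0 f g) ∧
        ∀ x, ‖(convFun s f g - convFun 0 f g) x‖ ≤ δ := by
  have hK : IsCompact ((Icc (-(3 * R)) (3 * R) ×ˢ Icc (-(3 * R)) (3 * R)) ×ˢ Icc (-R) R) :=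
    (isCompact_Icc.prod isCompact_Icc).prod isCompact_Icc
  filter_upwards [eventually_mem_domain f, eventually_abs_mul_le R,
    eventually_norm_sub_lt hK (fun y _ => (contDiffAt_kern f.2.1 g.2.1 y).continuousAt)
      (ε := δ / (2 * R)) (by positivity)] with s h1 hs h5
  have hsupp : SuppIn (3 * R) (convFun s f g - convFun 0 f g) :=
    (suppIn_convFun hR hs hRf hRg).sub (suppIn_convFun hR (by norm_num) hRf hRg)
  refine ⟨hsupp, fun x => ?_⟩
  by_cases hx : (convFun s f g - convFun 0 f g) x = 0
  · rw [hx, norm_zero]; exact hδ.le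
  obtain ⟨hx1, hx2, -⟩ := hsupp x hx
  have e : (convFun s f g - convFun 0 f g) x = ∫ c, (kern s f g x c - kern 0 f g x c) :=
    (integral_sub (integrable_kern (h1 s le_rfl) (continuous_of_mem_D g) x)
      (integrable_kern f.2 (continuous_of_mem_D g) x)).symm
  rw [e]
  refine (norm_integral_le_of_support (R := R) (ε := δ / (2 * R)) (by linarith)
    (fun c hc => ?_) fun c hc =>
      (h5 (x, c) ⟨⟨abs_le.1 hx1, abs_le.1 hx2⟩, abs_le.1 hc⟩).le).trans_eq (by field_simp)
  by_cases h : kern s f g x c = 0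
  · exact hRf.kern (s := 0) (g := g) (x := x) fun h' => hc (by rw [h, h', sub_zero])
  · exact hRf.kern h

theorem redNorm_product_lt (f g : D 0) (ε : ℝ≥0∞) (hε : 0 < ε) : ∀ᶠ s : ℝ in 𝓝 0,
    ∃ (hf : f ∈ (Q s).domain) (hg : g ∈ (Q s).domain) (hfg : conv 0 f g ∈ (Q s).domain),
      redNorm s (conv s (Q s ⟨f, hf⟩) (Q s ⟨g, hg⟩) - Q s ⟨conv 0 f g, hfg⟩) < ε := by
  obtain ⟨R, hR, hRf, hRg⟩ := exists_suppIn₂ f g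
  obtain ⟨δ, hδ, H⟩ := exists_redNorm_lt (η := 1 / 2) (R := 3 * R) (by norm_num) (by positivity) hε
  filter_upwards [eventually_mem_domain f, eventually_mem_domain g,
    eventually_mem_domain (conv 0 f g), eventually_abs_mul_le (3 * R),
    eventually_convFun_sub_le f g hR hRf hRg hδ] with s h1 h2 h3 h4 h5
  refine ⟨h1, h2, h3, H s _ (fun x hx => ?_) h5.2⟩
  have hx' : |x.1| ≤ 3 * R := (h5.1 x hx).1
  exact ⟨hx', (abs_one_add_mem h4 hx').1⟩

/-! ### The commutator -/

/-- `∂f/∂b`. -/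
noncomputable def dB (f : ℝ × ℝ → ℂ) (x : ℝ × ℝ) : ℂ := fderiv ℝ f x (1, 0)

theorem continuous_dA {f : ℝ × ℝ → ℂ} (hf : ContDiff ℝ ∞ f) : Continuous (dA f) :=
  (hf.continuous_fderiv (by simp)).clm_apply continuous_const

theorem continuous_dB {f : ℝ × ℝ → ℂ} (hf : ContDiff ℝ ∞ f) : Continuous (dB f) :=
  (hf.continuous_fderiv (by simp)).clm_apply continuous_const

theorem fderiv_eq_dB_add_dA (f : ℝ × ℝ → ℂ) (x : ℝ × ℝ) (u v : ℝ) :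
    fderiv ℝ f x (u, v) = u * dB f x + v * dA f x := by
  have e : ((u, v) : ℝ × ℝ) = u • ((1 : ℝ), (0 : ℝ)) + v • ((0 : ℝ), (1 : ℝ)) := by ext <;> simp
  rw [e, map_add, map_smul, map_smul]
  simp [dA, dB]

theorem hasDerivAt_comp_prodMk {f : ℝ × ℝ → ℂ} (hf : ContDiff ℝ ∞ f) {u v : ℝ → ℝ}
    {u' v' t : ℝ} (hu : HasDerivAt u u' t) (hv : HasDerivAt v v' t) :
    HasDerivAt (fun t => f (u t, v t)) (u' * dB f (u t, v t) + v' * dA f (u t, v t)) t := by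
  rw [← fderiv_eq_dB_add_dA]
  exact ((hf.differentiable (by simp)).differentiableAt
    (x := (u t, v t))).hasFDerivAt.comp_hasDerivAt t (hu.prodMk hv)

/-- The derivative of `kern s f g x c` at `s = 0`. -/
noncomputable def kernDeriv (f g : ℝ × ℝ → ℂ) (x : ℝ × ℝ) (c : ℝ) : ℂ :=
  -c * f (c, x.2) * g (x.1 - c, x.2) + (c - x.1) * dA f (c, x.2) * g (x.1 - c, x.2) -
    c * (x.1 - c) * f (c, x.2) * dB g (x.1 - c, x.2) - x.2 * c * f (c, x.2) * dA g (x.1 - c, x.2)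

theorem hasDerivAt_kern {f g : ℝ × ℝ → ℂ} (hf : ContDiff ℝ ∞ f) (hg : ContDiff ℝ ∞ g)
    (x : ℝ × ℝ) (c : ℝ) :
    HasDerivAt (fun s => kern s f g x c) (kernDeriv f g x c) 0 := by
  have h0 : (1 : ℝ) + 0 * c ≠ 0 := by simp
  have h1 : HasDerivAt (fun s : ℝ => 1 + s * c) c 0 := by
    simpa using ((hasDerivAt_id (0 : ℝ)).mul_const c).const_add 1
  have h2 : HasDerivAt (fun s : ℝ => ((|1 + s * c|⁻¹ : ℝ) : ℂ)) ((-c : ℝ) : ℂ) 0 := by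
    have h3 : HasDerivAt (fun s : ℝ => (1 + s * c)⁻¹) (-c) 0 :=
      (h1.inv h0).congr_deriv (by simp)
    refine h3.ofReal_comp.congr_of_eventuallyEq ?_
    filter_upwards [h1.continuousAt.eventually (lt_mem_nhds (by norm_num : (0 : ℝ) < 1 + 0 * c))]
      with s hs
    rw [abs_of_pos hs]
  have h4 : HasDerivAt (fun s : ℝ => x.2 + s * (c - x.1)) (c - x.1) 0 := by
    simpa using ((hasDerivAt_id (0 : ℝ)).mul_const (c - x.1)).const_add x.2
  have h5 : HasDerivAt (fun s : ℝ => (x.1 - c) / (1 + s * c)) (-(c * (x.1 - c))) 0 := by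
    refine ((hasDerivAt_const _ _).div h1 h0).congr_deriv ?_
    simp; ring
  have h6 : HasDerivAt (fun s : ℝ => x.2 / (1 + s * c)) (-(x.2 * c)) 0 := by
    refine ((hasDerivAt_const _ _).div h1 h0).congr_deriv ?_
    simp
  refine ((h2.mul (hasDerivAt_comp_prodMk hf (hasDerivAt_const _ c) h4)).mul
    (hasDerivAt_comp_prodMk hg h5 h6)).congr_deriv ?_
  simp [kernDeriv]
  ring

theorem hasCompactSupport_of_support {R : ℝ} {h : ℝ → ℂ} (hs : ∀ c, h c ≠ 0 → |c| ≤ R) :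
    HasCompactSupport h :=
  HasCompactSupport.intro (isCompact_Icc (a := -R) (b := R)) fun c hc => by
    by_contra h0
    exact hc (abs_le.1 (hs c h0))

theorem SuppIn.dA {R : ℝ} {f : ℝ × ℝ → ℂ} (hf : SuppIn R f) {c a : ℝ} (h : dA f (c, a) ≠ 0) :
    |c| ≤ R := by
  have h1 : (c, a) ∈ tsupport f := by
    refine tsupport_fderiv_subset ℝ (subset_tsupport _ ?_)
    intro h0
    exact h (by simp [AxB.dA, h0])
  have h2 : tsupport f ⊆ {x | |x.1| ≤ R} :=
    closure_minimal (fun x hx => (hf x hx).1) (isClosed_le (by fun_prop) (by fun_prop))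
  exact h2 h1

theorem SuppIn.kernDeriv {R : ℝ} {f g : ℝ × ℝ → ℂ} (hf : SuppIn R f) {x : ℝ × ℝ} {c : ℝ}
    (hc : kernDeriv f g x c ≠ 0) : |c| ≤ R := by
  by_contra h
  have h1 : f (c, x.2) = 0 := by
    by_contra h'; exact h (hf _ h').1
  have h2 : AxB.dA f (c, x.2) = 0 := by
    by_contra h'; exact h (hf.dA h')
  exact hc (by simp [AxB.kernDeriv, h1, h2])

theorem integrable_kernDeriv {R : ℝ} {f g : ℝ × ℝ → ℂ} (hf : ContDiff ℝ ∞ f) (hRf : SuppIn R f)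
    (hg : ContDiff ℝ ∞ g) (x : ℝ × ℝ) : Integrable (kernDeriv f g x) := by
  refine Continuous.integrable_of_hasCompactSupport ?_
    (hasCompactSupport_of_support fun c hc => hRf.kernDeriv hc)
  have h1 := hf.continuous
  have h2 := hg.continuous
  have h3 := continuous_dA hf
  have h4 := continuous_dA hg
  have h5 := continuous_dB hg
  unfold kernDeriv
  fun_prop

theorem kern_zero (f g : ℝ × ℝ → ℂ) (x : ℝ × ℝ) (c : ℝ) :
    kern 0 f g x c = f (c, x.2) * g (x.1 - c, x.2) := by
  simp [kern]

/-- At `s = 0` the product is ordinary convolution in `b` at fixed `a`, and `c ↦ b - c` exchanges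
the factors. -/
theorem convFun_zero_comm (f g : ℝ × ℝ → ℂ) (x : ℝ × ℝ) : convFun 0 f g x = convFun 0 g f x := by
  change ∫ c, kern 0 f g x c = ∫ c, kern 0 g f x c
  rw [← integral_sub_left_eq_self (fun c => kern 0 g f x c) volume x.1]
  congr 1 with c
  simp [kern_zero, mul_comm]

theorem integral_kernDeriv_sub (f g : D 0) (x : ℝ × ℝ) :
    (∫ c, kernDeriv f g x c) - ∫ c, kernDeriv g f x c = (bracket f g : ℝ × ℝ → ℂ) x := by
  obtain ⟨R, hR, hRf, hRg⟩ := exists_suppIn₂ f g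
  have hf := f.2.1
  have hg := g.2.1
  have cf := hf.continuous
  have cg := hg.continuous
  have hbr : (bracket f g : ℝ × ℝ → ℂ) x = ((x.2 - 1 : ℝ) : ℂ) *
      (convFun 0 (partialA f) (mulB g) x - convFun 0 (mulB f) (partialA g) x) := by
    rw [convFun_zero_comm (mulB f) (partialA g)]; rfl
  have i1 := integrable_kern (partialA f).2 (continuous_of_mem_D (mulB g)) x
  have i2 := integrable_kern (mulB f).2 (continuous_of_mem_D (partialA g)) x
  have i3 := integrable_kernDeriv hf hRf hg x
  have i4 := (integrable_kernDeriv hg hRg hf x).comp_sub_left x.1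
  -- `P` is chosen to absorb the terms of the antisymmetrized derivative that contain `∂_b` or no
  -- derivative at all: these form `P'`, whose integral vanishes because `P` has compact support.
  set P : ℝ → ℂ := fun c => (c : ℂ) * ((x.1 - c : ℝ) : ℂ) *
    ((f : ℝ × ℝ → ℂ) (c, x.2) * (g : ℝ × ℝ → ℂ) (x.1 - c, x.2)) with hP
  set P' : ℝ → ℂ := fun c => ((x.1 - 2 * c : ℝ) : ℂ) *
      ((f : ℝ × ℝ → ℂ) (c, x.2) * (g : ℝ × ℝ → ℂ) (x.1 - c, x.2)) +
    (c : ℂ) * ((x.1 - c : ℝ) : ℂ) * (dB f (c, x.2) * (g : ℝ × ℝ → ℂ) (x.1 - c, x.2) -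
      (f : ℝ × ℝ → ℂ) (c, x.2) * dB g (x.1 - c, x.2)) with hP'
  have hderiv : ∀ c, HasDerivAt P (P' c) c := by
    intro c
    have d1 : HasDerivAt (fun c : ℝ => x.1 - c) (-1) c := by
      simpa using (hasDerivAt_id c).const_sub x.1
    have d2 := hasDerivAt_comp_prodMk hf (hasDerivAt_id c) (hasDerivAt_const c x.2)
    have d3 := hasDerivAt_comp_prodMk hg d1 (hasDerivAt_const c x.2)
    refine (((hasDerivAt_id c).ofReal_comp.mul d1.ofReal_comp).mul (d2.mul d3)).congr_deriv ?_
    simp [hP']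
    ring
  -- The second integrand is reflected by `c ↦ b - c`, so that both products are evaluated at the
  -- same pair of points.
  have key : ∀ c, kernDeriv f g x c - kernDeriv g f x (x.1 - c) = P' c +
      ((x.2 - 1 : ℝ) : ℂ) * (kern 0 (partialA f) (mulB g) x c -
        kern 0 (mulB f) (partialA g) x c) := by
    intro c
    simp only [kern_zero, kernDeriv, hP', partialA, mulB, sub_sub_cancel]
    push_cast
    ring
  have iP' : Integrable P' := by
    have : P' = fun c => (kernDeriv f g x c - kernDeriv g f x (x.1 - c)) -
      ((x.2 - 1 : ℝ) : ℂ) * (kern 0 (partialA f) (mulB g) x c -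
        kern 0 (mulB f) (partialA g) x c) := by
      funext c; rw [key]; ring
    rw [this]
    exact (i3.sub i4).sub ((i1.sub i2).const_mul _)
  have iP : Integrable P := by
    refine Continuous.integrable_of_hasCompactSupport (by fun_prop)
      (hasCompactSupport_of_support (R := R) fun c hc => ?_)
    exact (hRf _ (left_ne_zero_of_mul (right_ne_zero_of_mul hc))).1
  rw [← integral_sub_left_eq_self (fun c => kernDeriv g f x c) volume x.1, ← integral_sub i3 i4]
  simp_rw [key]
  rw [integral_add iP' (by exact (i1.sub i2).const_mul _), integral_const_mul, integral_sub i1 i2,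
    integral_eq_zero_of_hasDerivAt_of_integrable hderiv iP' iP, zero_add, hbr]
  rfl

theorem eventually_convFun_sub_sub_le (f g : D 0) {R A ε : ℝ} (hR : 1 ≤ R) (hRf : SuppIn R f)
    (hε : 0 < ε) : ∀ᶠ s : ℝ in 𝓝 0, ∀ x : ℝ × ℝ, |x.1| ≤ A → |x.2| ≤ A →
      ‖convFun s f g x - convFun 0 f g x - s • ∫ c, kernDeriv f g x c‖ ≤ ε * |s| := by
  have hK : IsCompact ((Icc (-A) A ×ˢ Icc (-A) A) ×ˢ Icc (-R) R) :=
    (isCompact_Icc.prod isCompact_Icc).prod isCompact_Icc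
  filter_upwards [eventually_mem_domain f,
    eventually_norm_sub_sub_le hK (contDiffAt_kern f.2.1 g.2.1)
      (fun y => hasDerivAt_kern f.2.1 g.2.1 y.1 y.2) (ε := ε / (2 * R)) (by positivity)]
    with s h1 h2 x hx1 hx2
  have i1 := integrable_kern (h1 s le_rfl) (continuous_of_mem_D g) x
  have i2 := integrable_kern f.2 (continuous_of_mem_D g) x
  have i3 := integrable_kernDeriv f.2.1 hRf g.2.1 x
  have e : convFun s f g x - convFun 0 f g x - s • ∫ c, kernDeriv f g x c =
      ∫ c, (kern s f g x c - kern 0 f g x c - s • kernDeriv f g x c) := by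
    rw [integral_sub (by exact i1.sub i2) (by exact i3.smul s), integral_sub i1 i2, integral_smul]
    rfl
  rw [e]
  refine (norm_integral_le_of_support (R := R) (ε := ε / (2 * R) * |s|) (by linarith)
    (fun c hc => ?_) fun c hc =>
      h2 (x, c) ⟨⟨abs_le.1 hx1, abs_le.1 hx2⟩, abs_le.1 hc⟩).trans_eq (by field_simp)
  by_contra hcR
  have k1 : kern s f g x c = 0 := by_contra fun h => hcR (hRf.kern h)
  have k2 : kern 0 f g x c = 0 := by_contra fun h => hcR (hRf.kern h)
  have k3 : kernDeriv f g x c = 0 := by_contra fun h => hcR (hRf.kernDeriv h)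
  exact hc (by simp [k1, k2, k3])

theorem redNorm_commutator_lt (f g : D 0) (ε : ℝ≥0∞) (hε : 0 < ε) : ∀ᶠ s : ℝ in 𝓝[≠] 0,
    ∃ (hf : f ∈ (Q s).domain) (hg : g ∈ (Q s).domain) (hfg : bracket f g ∈ (Q s).domain),
      redNorm s ((1 / (s : ℂ)) • comm s (Q s ⟨f, hf⟩) (Q s ⟨g, hg⟩) -
        Q s ⟨bracket f g, hfg⟩) < ε := by
  obtain ⟨R₁, hR₁, hRf, hRg⟩ := exists_suppIn₂ f g
  obtain ⟨R₂, -, hRb⟩ := exists_suppIn (bracket f g)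
  set A := max (3 * R₁) R₂ with hA
  have hA0 : 0 ≤ A := le_max_of_le_left (by positivity)
  obtain ⟨δ, hδ, H⟩ := exists_redNorm_lt (η := 1 / 2) (R := A) (by norm_num) hA0 hε
  filter_upwards [nhdsWithin_le_nhds (eventually_mem_domain f),
    nhdsWithin_le_nhds (eventually_mem_domain g),
    nhdsWithin_le_nhds (eventually_mem_domain (bracket f g)),
    nhdsWithin_le_nhds (eventually_abs_mul_le A), nhdsWithin_le_nhds (eventually_abs_mul_le R₁),
    nhdsWithin_le_nhds (eventually_convFun_sub_sub_le f g (A := A) hR₁ hRf (half_pos hδ)),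
    nhdsWithin_le_nhds (eventually_convFun_sub_sub_le g f (A := A) hR₁ hRg (half_pos hδ)),
    self_mem_nhdsWithin] with s h1 h2 h3 h4 h5 h6 h7 (hs : s ≠ 0)
  set F : ℝ × ℝ → ℂ := fun x => (1 / (s : ℂ)) * (convFun s f g x - convFun s g f x) -
    (bracket f g : ℝ × ℝ → ℂ) x with hF
  have hsupp : SuppIn A F := by
    intro x hx
    by_cases hb : (bracket f g : ℝ × ℝ → ℂ) x = 0
    · by_cases hc : (convFun s f g - convFun s g f) x = 0
      · exact absurd (by simpa [hF, hb, hs] using hc) hx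
      · exact ((suppIn_convFun hR₁ h5 hRf hRg).sub (suppIn_convFun hR₁ h5 hRg hRf)).mono
          (le_max_left _ _) x hc
    · exact hRb.mono (le_max_right _ _) x hb
  refine ⟨h1, h2, h3, H s _ (fun x (hx : F x ≠ 0) => ?_) (fun x => ?_)⟩
  · exact ⟨(hsupp x hx).1, (abs_one_add_mem h4 (hsupp x hx).1).1⟩
  · change ‖F x‖ ≤ δ
    by_cases hx : F x = 0
    · rw [hx, norm_zero]; exact hδ.le
    obtain ⟨hx1, hx2, -⟩ := hsupp x hx
    have hsC : (s : ℂ) ≠ 0 := by exact_mod_cast hs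
    -- The zeroth-order terms cancel by commutativity of `*_0`, and the bracket is the difference of
    -- the first-order terms. What remains is at most `δ |s|`, which survives division by `s`.
    have e : F x = (s : ℂ)⁻¹ *
        ((convFun s f g x - convFun 0 f g x - s • ∫ c, kernDeriv f g x c) -
          (convFun s g f x - convFun 0 g f x - s • ∫ c, kernDeriv g f x c)) := by
      simp only [hF, ← integral_kernDeriv_sub, convFun_zero_comm (f := g) (g := f),
        Complex.real_smul]
      field_simp
      ring
    rw [e, norm_mul, norm_inv, Complex.norm_real, Real.norm_eq_abs]
    have hs' : 0 < |s| := abs_pos.2 hs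
    rw [inv_mul_le_iff₀ hs']
    refine (norm_sub_le_of_le (h6 x hx1 hx2) (h7 x hx1 hx2)).trans_eq ?_
    ring

/-! ### Continuity of the norm -/

/-- `G` is the dilate `|t₀ / t| f(t₀ b / t, a)`, with the same norm at `t₀` as `f` has at `t`; it
tends uniformly to `f` with controlled support. Both signs of the difference are bounded for the two
triangle inequalities. -/
theorem eventually_redNorm_rescale {t₀ : ℝ} (ht₀ : t₀ ≠ 0) (f : D t₀) {ε : ℝ≥0∞} (hε : 0 < ε) :
    ∀ᶠ t in 𝓝 t₀, ∀ h : (f : ℝ × ℝ → ℂ) ∈ D t, ∃ G : D t₀,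
      redNorm t ⟨f, h⟩ = redNorm t₀ G ∧ redNorm t₀ (G - f) < ε ∧ redNorm t₀ (f - G) < ε := by
  obtain ⟨R, η, -, hR, hη, -, hf, -⟩ := exists_bounds f
  obtain ⟨δ, hδ, H⟩ := exists_redNorm_lt (η := η / 2) (R := 2 * R) (by positivity)
    (by positivity) hε
  have hK : IsCompact (Icc (-(2 * R)) (2 * R) ×ˢ Icc (-R) R) := isCompact_Icc.prod isCompact_Icc
  set F : ℝ × (ℝ × ℝ) → ℂ := fun p =>
    ((|t₀ / p.1| : ℝ) : ℂ) * (f : ℝ × ℝ → ℂ) (t₀ / p.1 * p.2.1, p.2.2) with hF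
  have hFcont : ∀ x, ContinuousAt F (t₀, x) := by
    intro x
    have h1 : ContinuousAt (fun p : ℝ × (ℝ × ℝ) => t₀ / p.1) (t₀, x) :=
      ContinuousAt.div (by fun_prop) (by fun_prop) ht₀
    have h2 : ContinuousAt (fun p : ℝ × (ℝ × ℝ) => (t₀ / p.1 * p.2.1, p.2.2)) (t₀, x) :=
      (h1.mul (by fun_prop)).prodMk (by fun_prop)
    exact (Complex.continuous_ofReal.continuousAt.comp (continuous_abs.continuousAt.comp h1)).mul
      ((continuous_of_mem_D f).continuousAt.comp h2)
  have c1 : ContinuousAt (fun t : ℝ => |t₀ / t|) t₀ :=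
    (ContinuousAt.div (by fun_prop) (by fun_prop) ht₀).abs
  have c2 : ContinuousAt (fun t : ℝ => |t - t₀| * R) t₀ := by fun_prop
  filter_upwards [eventually_ne_nhds ht₀,
    c1.eventually (lt_mem_nhds (by simp [ht₀]; norm_num : (1 / 2 : ℝ) < |t₀ / t₀|)),
    c2.eventually (gt_mem_nhds (by simpa using hη : |t₀ - t₀| * R < η / 2)),
    eventually_norm_sub_lt hK (fun x _ => hFcont x) hδ] with t h1 h2 h3 h4 h
  have hr : t₀ / t ≠ 0 := div_ne_zero ht₀ h1
  have hG : (fun x => F (t, x)) ∈ D t₀ :=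
    (D t₀).smul_mem ((|t₀ / t| : ℝ) : ℂ) (comp_mul_fst_mem_D hr (div_mul_cancel₀ _ h1).symm h)
  have hsupp : ∀ x, F (t, x) - (f : ℝ × ℝ → ℂ) x ≠ 0 →
      |x.1| ≤ 2 * R ∧ |x.2| ≤ R ∧ η / 2 ≤ |1 + t₀ * x.1| := by
    intro x hx
    by_cases h0 : (f : ℝ × ℝ → ℂ) x = 0
    · have h5 : (f : ℝ × ℝ → ℂ) (t₀ / t * x.1, x.2) ≠ 0 := fun h' => hx (by simp [hF, h0, h'])
      obtain ⟨k1, k2, -, k3⟩ := hf _ h5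
      simp only [abs_mul] at k1
      have k4 : 1 / 2 * |x.1| ≤ |t₀ / t| * |x.1| := by gcongr
      refine ⟨by linarith, k2, ?_⟩
      -- The support of `f` bounds `1 + t₀ b'` below at the dilated point `b' = t₀ b / t`; since `t₀
      -- b = t b'`, passing to `1 + t₀ b` costs at most `|t - t₀| R < η / 2`.
      have e : 1 + t₀ * (t₀ / t * x.1) = (1 + t₀ * x.1) - (t - t₀) * (t₀ / t * x.1) := by
        field_simp; ring
      rw [e] at k3
      have k5 : |(t - t₀) * (t₀ / t * x.1)| ≤ |t - t₀| * R := by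
        rw [abs_mul, abs_mul (t₀ / t)]; gcongr
      have k6 := abs_sub (1 + t₀ * x.1) ((t - t₀) * (t₀ / t * x.1))
      linarith
    · obtain ⟨k1, k2, -, k3⟩ := hf _ h0
      exact ⟨by linarith, k2, by linarith⟩
  have hbound : ∀ x, ‖F (t, x) - (f : ℝ × ℝ → ℂ) x‖ ≤ δ := by
    intro x
    by_cases hx : F (t, x) - (f : ℝ × ℝ → ℂ) x = 0
    · rw [hx, norm_zero]; exact hδ.le
    · have e : (f : ℝ × ℝ → ℂ) x = F (t₀, x) := by simp [hF, ht₀]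
      rw [e]
      exact (h4 x ⟨abs_le.1 (hsupp x hx).1, abs_le.1 (hsupp x hx).2.1⟩).le
  refine ⟨⟨_, hG⟩, redNorm_rescale hr (div_mul_cancel₀ _ h1).symm _ _ fun x => rfl,
    H _ _ (fun x hx => ⟨(hsupp x hx).1, (hsupp x hx).2.2⟩) hbound,
    H _ _ (fun x hx => ?_) (fun x => ?_)⟩
  · have hx' : F (t, x) - (f : ℝ × ℝ → ℂ) x ≠ 0 := fun h0 => hx (by
      change (f : ℝ × ℝ → ℂ) x - F (t, x) = 0
      rw [← neg_sub, h0, neg_zero])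
    exact ⟨(hsupp x hx').1, (hsupp x hx').2.2⟩
  · change ‖(f : ℝ × ℝ → ℂ) x - F (t, x)‖ ≤ δ
    rw [norm_sub_rev]; exact hbound x

theorem continuousAt_redNorm (f : D 0) (s : {s : ℝ // f ∈ (Q s).domain}) (hs : (s : ℝ) ≠ 0) :
    ContinuousAt (fun t : {t : ℝ // f ∈ (Q t).domain} => redNorm t (Q t ⟨f, t.2⟩)) s := by
  refine (ENNReal.tendsto_nhds (redNorm_lt_top _ _).ne).2 fun ε hε => ?_
  filter_upwards [continuousAt_subtype_val.eventually
    (eventually_redNorm_rescale hs (Q s ⟨f, s.2⟩) hε)] with t ht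
  obtain ⟨G, h1, h2, h3⟩ := ht (t.2 t le_rfl)
  have h4 := redNorm_add_le (G - Q s ⟨f, s.2⟩) (Q s ⟨f, s.2⟩)
  have h5 := redNorm_add_le ((Q s ⟨f, s.2⟩ : D s) - G) G
  rw [sub_add_cancel] at h4 h5
  have h6 : redNorm t (Q t ⟨f, t.2⟩) = redNorm s G := h1
  rw [h6]
  refine ⟨tsub_le_iff_right.2 (h5.trans ?_), h4.trans ?_⟩
  · rw [add_comm]; gcongr
  · rw [add_comm]; gcongr

/-- On the support the density `a⁻²` is at most `R²`, and the box containing it has area `(2R)²`. -/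
theorem l2norm_le_of_suppIn {R δ : ℝ} (hR : 0 ≤ R) {h : ℝ × ℝ → ℂ} (hm : Measurable h)
    (hs : SuppIn R h) (hδ : ∀ x, ‖h x‖ ≤ δ) :
    l2norm h ≤ ENNReal.ofReal (R * (2 * R)) * ENNReal.ofReal δ := by
  rw [← ENNReal.pow_le_pow_left_iff two_ne_zero, l2norm_sq, lintegral_planeMeasure (by fun_prop)]
  set K : Set (ℝ × ℝ) := Icc (-R) R ×ˢ Icc (-R) R with hK
  have hKm : MeasurableSet K := measurableSet_Icc.prod measurableSet_Icc
  calc ∫⁻ x : ℝ × ℝ, ENNReal.ofReal (1 / x.2 ^ 2) * ‖h x‖ₑ ^ 2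
      ≤ ∫⁻ x, K.indicator (fun _ => ENNReal.ofReal R ^ 2 * ENNReal.ofReal δ ^ 2) x := by
        refine lintegral_mono fun x => ?_
        by_cases hx : h x = 0
        · simp [hx]
        obtain ⟨h1, h2, h3⟩ := hs x hx
        rw [indicator_of_mem (show x ∈ K from ⟨abs_le.1 h1, abs_le.1 h2⟩), ← ofReal_norm,
          ← ENNReal.ofReal_pow hR]
        have h4 : 1 / x.2 ^ 2 ≤ R ^ 2 := by
          have hx2 : 0 < |x.2| := by
            rcases (abs_nonneg x.2).eq_or_lt with h0 | h0
            · rw [← h0] at h3; norm_num at h3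
            · exact h0
          rw [← sq_abs, div_le_iff₀ (by positivity), ← mul_pow]
          exact one_le_pow₀ h3
        gcongr
        exact hδ x
    _ = (ENNReal.ofReal (R * (2 * R)) * ENNReal.ofReal δ) ^ 2 := by
        rw [lintegral_indicator_const hKm, hK, Measure.volume_eq_prod, Measure.prod_prod,
          Real.volume_Icc, ENNReal.ofReal_mul hR]
        rw [show R - -R = 2 * R by ring]
        ring

theorem l2norm_lt_top {s : ℝ} (g : D s) : l2norm (g : ℝ × ℝ → ℂ) < ⊤ := by
  obtain ⟨R, η, M, hR, hη, -, h, hM⟩ := exists_bounds g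
  have hs : SuppIn (max R η⁻¹) (g : ℝ × ℝ → ℂ) := fun x hx => by
    obtain ⟨h1, h2, h3, -⟩ := h x hx
    refine ⟨h1.trans (le_max_left _ _), h2.trans (le_max_left _ _), ?_⟩
    calc 1 = η⁻¹ * η := (inv_mul_cancel₀ hη.ne').symm
      _ ≤ _ := by gcongr; simp
  exact (l2norm_le_of_suppIn (by positivity) (continuous_of_mem_D g).measurable hs hM).trans_lt
    (ENNReal.mul_lt_top ENNReal.ofReal_lt_top ENNReal.ofReal_lt_top)

theorem mul_l2norm_lt_of_lt_div {y : ℝ≥0∞} (f g : D 0)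
    (hy : y < l2norm (conv 0 f g : ℝ × ℝ → ℂ) / l2norm (g : ℝ × ℝ → ℂ)) :
    y * l2norm (g : ℝ × ℝ → ℂ) < l2norm (conv 0 f g : ℝ × ℝ → ℂ) := by
  refine (ENNReal.lt_div_iff_mul_lt (Or.inr ?_) (Or.inl (l2norm_lt_top g).ne)).1 hy
  intro h
  simp [h] at hy

theorem lowerSemicontinuousAt_redNorm (f : D 0) (s : {s : ℝ // f ∈ (Q s).domain})
    (hs : (s : ℝ) = 0) :
    LowerSemicontinuousAt
      (fun t : {t : ℝ // f ∈ (Q t).domain} => redNorm t (Q t ⟨f, t.2⟩)) s := by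
  obtain ⟨s, hs'⟩ := s
  obtain rfl : s = 0 := hs
  intro y hy
  obtain ⟨g, hg⟩ := lt_iSup_iff.1 hy
  have hlt := mul_l2norm_lt_of_lt_div f g hg
  obtain ⟨R, hR, hRf, hRg⟩ := exists_suppIn₂ f g
  set A := l2norm (conv 0 f g : ℝ × ℝ → ℂ) with hA
  set B := l2norm (g : ℝ × ℝ → ℂ) with hB
  obtain ⟨e, he0, he⟩ := ENNReal.lt_iff_exists_nnreal_btwn.1 (tsub_pos_of_lt hlt)
  -- This tolerance cancels the constant of `l2norm_le_of_suppIn` at radius `3R`, making the `L²`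
  -- error at most `e`, which is smaller than the gap `A - y B`.
  have hev := eventually_convFun_sub_le f g hR hRf hRg
    (δ := e / (3 * R * (2 * (3 * R)))) (div_pos (by exact_mod_cast he0) (by positivity))
  filter_upwards [continuousAt_subtype_val.eventually hev,
    continuousAt_subtype_val.eventually (eventually_mem_domain g)] with t h1 h2
  have hgt : (g : ℝ × ℝ → ℂ) ∈ D t := h2 t le_rfl
  have hft : (f : ℝ × ℝ → ℂ) ∈ D t := t.2 t le_rfl
  have m0 : Continuous (convFun 0 f g) := (convFun_contDiff f.2 g.2).continuous
  have mt : Continuous (convFun t f g) := (convFun_contDiff hft hgt).continuous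
  have hE : l2norm (convFun t f g - convFun 0 f g) ≤ e := by
    refine (l2norm_le_of_suppIn (by positivity) (mt.sub m0).measurable h1.1 h1.2).trans_eq ?_
    rw [← ENNReal.ofReal_mul (by positivity), mul_div_cancel₀ _ (by positivity),
      ENNReal.ofReal_coe_nnreal]
  have hAt : A ≤ l2norm (convFun t f g) + e := by
    have e1 : convFun 0 f g = convFun t f g - (convFun t f g - convFun 0 f g) := by abel
    have h3 : A = l2norm (convFun t f g - (convFun t f g - convFun 0 f g)) := by
      rw [← e1]; rfl
    rw [h3]
    exact (eLpNorm_sub_le mt.aestronglyMeasurable (mt.sub m0).aestronglyMeasurable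
      (by norm_num)).trans (add_le_add_right hE _)
  have hfin : y * B < l2norm (convFun t f g) := by
    by_contra! hcon
    have : A < A := calc
      A ≤ y * B + e := hAt.trans (by gcongr)
      _ < y * B + (A - y * B) := (ENNReal.add_lt_add_iff_left (hlt.trans_le le_top).ne).2 he
      _ = A := add_tsub_cancel_of_le hlt.le
    exact this.false
  -- The same `g` serves as a test function at `t`: its `L²` norm does not depend on the parameter.
  refine lt_of_lt_of_le ?_ (le_iSup (fun g' : D t => l2norm (conv t (Q t ⟨f, t.2⟩) g' :
    ℝ × ℝ → ℂ) / l2norm (g' : ℝ × ℝ → ℂ)) ⟨g, hgt⟩)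
  exact (ENNReal.lt_div_iff_mul_lt (Or.inr (hy.trans_le le_top).ne)
    (Or.inl (l2norm_lt_top g).ne)).2 hfin

end AxB

open AxB in
theorem proposition6p3 :
    -- `D(Q_0) = 𝒟(Γ_0)` and `Q_0 = id`
    ((Q 0).domain = ⊤ ∧ ∀ f : (Q 0).domain, Q 0 f = f) ∧
    -- the norms are finite
    (∀ (s : ℝ) (f : D s), redNorm s f < ⊤) ∧
    -- every `f ∈ 𝒟(Γ_0)` belongs to `D(Q_s)` for all `s` in an open neighbourhood of `0`
    (∀ f : D 0, IsOpen {s : ℝ | f ∈ (Q s).domain} ∧ f ∈ (Q 0).domain) ∧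
    -- `‖Q_s(f^*) - Q_s(f)^{*_s}‖_s → 0`
    (∀ f : D 0, ∀ ε : ℝ≥0∞, 0 < ε → ∀ᶠ s : ℝ in 𝓝 0,
      ∃ (hf : f ∈ (Q s).domain) (hf' : invol 0 f ∈ (Q s).domain),
        redNorm s (Q s ⟨invol 0 f, hf'⟩ - invol s (Q s ⟨f, hf⟩)) < ε) ∧
    -- `‖Q_s(f) *_s Q_s(g) - Q_s(f * g)‖_s → 0`
    (∀ f g : D 0, ∀ ε : ℝ≥0∞, 0 < ε → ∀ᶠ s : ℝ in 𝓝 0,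
      ∃ (hf : f ∈ (Q s).domain) (hg : g ∈ (Q s).domain) (hfg : conv 0 f g ∈ (Q s).domain),
        redNorm s (conv s (Q s ⟨f, hf⟩) (Q s ⟨g, hg⟩) - Q s ⟨conv 0 f g, hfg⟩) < ε) ∧
    -- `‖(1/s) [Q_s(f), Q_s(g)] - Q_s({f, g})‖_s → 0`
    (∀ f g : D 0, ∀ ε : ℝ≥0∞, 0 < ε → ∀ᶠ s : ℝ in 𝓝[≠] 0,
      ∃ (hf : f ∈ (Q s).domain) (hg : g ∈ (Q s).domain) (hfg : bracket f g ∈ (Q s).domain),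
        redNorm s ((1 / (s : ℂ)) • comm s (Q s ⟨f, hf⟩) (Q s ⟨g, hg⟩) -
          Q s ⟨bracket f g, hfg⟩) < ε) ∧
    -- `s ↦ ‖Q_s(f)‖_s` is continuous at `s ≠ 0` and lower semicontinuous at `0`
    (∀ f : D 0,
      (∀ s : {s : ℝ // f ∈ (Q s).domain}, (s : ℝ) ≠ 0 →
        ContinuousAt (fun t : {t : ℝ // f ∈ (Q t).domain} => redNorm t (Q t ⟨f, t.2⟩)) s) ∧
      (∀ s : {s : ℝ // f ∈ (Q s).domain}, (s : ℝ) = 0 →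
        LowerSemicontinuousAt
          (fun t : {t : ℝ // f ∈ (Q t).domain} => redNorm t (Q t ⟨f, t.2⟩)) s)) :=
  ⟨⟨eq_top_iff.2 fun f _ => mem_domain_zero f, fun _ => rfl⟩, redNorm_lt_top,
    fun f => ⟨isOpen_domain f, mem_domain_zero f⟩, redNorm_involution_lt, redNorm_product_lt,
    redNorm_commutator_lt,
    fun f => ⟨continuousAt_redNorm f, lowerSemicontinuousAt_redNorm f⟩⟩
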